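/- All graphs are finite, simple and undirected. A graph is chordal if it has no induced cycle of length more than three. A minimal triangulation of a graph $G=(V,E)$ is a chordal graph $H=(V,E\cup F)$ such that $(V,E\cup F')$ is not chordal for every proper subset $F'\subsetneq F$. A set $\Omega\subseteq V$ is a potential maximal clique of $G$ if it is an inclusion-maximal clique of some minimal triangulation of $G$. For an integer $k\ge 0$, a quasi-clique of $(G,k)$ is a potential maximal clique $\Omega$ of $G$ for which there is a set $Z\subseteq\Omega$ with $|Z|\le 5\sqrt k$ such that $\Omega\setminus Z$ is a clique of $G$. **Lemma.** There are an algorithm and a constant $c$ such that, for every $n$-vertex graph $G$ and every integer $k\ge 0$, the algorithm on input $(G,k)$ enumerates all quasi-cliques of $(G,k)$ in time $n^{\mathcal O(\sqrt k)}$. Precisely, it outputs a list that contains every quasi-clique exactly once and nothing else, and it halts within $\max(n,2)^{\,c\sqrt{\max(k,1)}}$ steps; that is, within $n^{c\sqrt k}$ steps for $n\ge 2$, $k\ge 1$, and within $n^{c}$ steps for $n\ge 2$, $k=0$. Here an algorithm is a program of the imperative WHILE language over binary trees, in which every elementary operation (variable access, constant nil, cons, head, tail, assignment, test for nil) takes one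 step. This model is equivalent to Turing machines and random access machines up to polynomial overhead. $G$ (with vertices numbered $1,\dots,n$) is given by its adjacency matrix, $k$ is given in binary, and vertex sets are output as characteristic vectors. -/

import Mathlib

/-! ### Minimal triangulations, potential maximal cliques, quasi-cliques -/

namespace FillIn

section Graphs

variable {V : Type*}

/-- A graph is chordal if it has no induced cycle of length more than three. -/
def IsChordal (H : SimpleGraph V) : Prop :=
  ∀ m : ℕ, 4 ≤ m → IsEmpty (SimpleGraph.cycleGraph m ↪g H)

/-- `H` is a triangulation of `G`: a chordal graph on the same vertices, obtained by adding edges. -/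
def IsTriangulation (G H : SimpleGraph V) : Prop :=
  G ≤ H ∧ IsChordal H

/-- `H` is a minimal triangulation of `G`: no triangulation of `G` uses a proper subset of its
fill edges. -/
def IsMinimalTriangulation (G H : SimpleGraph V) : Prop :=
  Minimal (IsTriangulation G) H

/-- `Ω` is a potential maximal clique of `G`: an inclusion-maximal clique of some minimal
triangulation of `G`. -/
def IsPotentialMaximalClique (G : SimpleGraph V) (Ω : Finset V) : Prop :=
  ∃ H : SimpleGraph V, IsMinimalTriangulation G H ∧
    Maximal (fun K : Finset V => H.IsClique (K : Set V)) Ω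

/-- `Ω` is a quasi-clique of the instance `(G, k)`: a potential maximal clique of `G` that has a
subset `Z` of at most `5 √k` vertices such that `Ω \ Z` is a clique of `G`. -/
def IsQuasiClique (G : SimpleGraph V) (k : ℕ) (Ω : Finset V) : Prop :=
  IsPotentialMaximalClique G Ω ∧
    ∃ Z : Finset V, Z ⊆ Ω ∧ (Z.card : ℝ) ≤ 5 * √(k : ℝ) ∧
      G.IsClique ((Ω : Set V) \ (Z : Set V))

end Graphs

/-! ### The machine model

Algorithms are programs of the imperative language WHILE over binary trees (cons cells), with the
usual unit-cost time measure: every `cons`, `hd`, `tl`, variable access, assignment and test for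
`nil` costs one unit. A program has finitely many variables. Since the only operations are pointer
operations on cons cells, the model simulates Turing machines and random access machines, and is
simulated by them, with polynomial overhead. -/

/-- The data of the machine: binary trees without labels. -/
inductive Tree : Type
  | nil : Tree
  | cons (l r : Tree) : Tree

namespace Tree

/-- Left subtree (`nil` for the empty tree). -/
def hd : Tree → Tree
  | nil => nil
  | cons l _ => l

/-- Right subtree (`nil` for the empty tree). -/
def tl : Tree → Tree
  | nil => nil
  | cons _ r => r

end Tree

/-- The content of the variables of a program. -/
abbrev Store : Type := ℕ → Tree

/-- Expressions over the variables `0, 1, 2, …`. -/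
inductive Expr : Type
  | var (x : ℕ) : Expr
  | nil : Expr
  | cons (e f : Expr) : Expr
  | hd (e : Expr) : Expr
  | tl (e : Expr) : Expr

namespace Expr

/-- The value of an expression. -/
def eval (σ : Store) : Expr → Tree
  | var x => σ x
  | nil => Tree.nil
  | cons e f => Tree.cons (e.eval σ) (f.eval σ)
  | hd e => (e.eval σ).hd
  | tl e => (e.eval σ).tl

/-- The time needed to evaluate an expression: one unit per operation. -/
def cost : Expr → ℕ
  | var _ => 1
  | nil => 1
  | cons e f => e.cost + f.cost + 1
  | hd e => e.cost + 1
  | tl e => e.cost + 1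

end Expr

/-- Commands (programs). The tests of `ite` and `loop` succeed if the value is not `nil`. -/
inductive Com : Type
  | assign (x : ℕ) (e : Expr) : Com
  | seq (p q : Com) : Com
  | ite (e : Expr) (p q : Com) : Com
  | loop (e : Expr) (p : Com) : Com

/-- `Exec p σ σ' t`: started in store `σ`, the command `p` halts in store `σ'` after exactly
`t` units of time. -/
inductive Exec : Com → Store → Store → ℕ → Prop
  | assign (x : ℕ) (e : Expr) (σ : Store) :
      Exec (Com.assign x e) σ (Function.update σ x (e.eval σ)) (e.cost + 1)
  | seq {p q : Com} {σ σ' σ'' : Store} {s t : ℕ} :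
      Exec p σ σ' s → Exec q σ' σ'' t → Exec (Com.seq p q) σ σ'' (s + t)
  | ite_true {e : Expr} {p q : Com} {σ σ' : Store} {t : ℕ} :
      e.eval σ ≠ Tree.nil → Exec p σ σ' t → Exec (Com.ite e p q) σ σ' (e.cost + 1 + t)
  | ite_false {e : Expr} {p q : Com} {σ σ' : Store} {t : ℕ} :
      e.eval σ = Tree.nil → Exec q σ σ' t → Exec (Com.ite e p q) σ σ' (e.cost + 1 + t)
  | loop_stop {e : Expr} {p : Com} {σ : Store} :
      e.eval σ = Tree.nil → Exec (Com.loop e p) σ σ (e.cost + 1)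
  | loop_step {e : Expr} {p : Com} {σ σ' σ'' : Store} {s t : ℕ} :
      e.eval σ ≠ Tree.nil → Exec p σ σ' s → Exec (Com.loop e p) σ' σ'' t →
      Exec (Com.loop e p) σ σ'' (e.cost + 1 + s + t)

/-- The initial store: the input is in variable `0`, all other variables hold `nil`. -/
def initStore (input : Tree) : Store :=
  Function.update (fun _ => Tree.nil) 0 input

/-- On `input`, the program `p` halts after exactly `t` units of time with `output` in
variable `0`. -/
def Outputs (p : Com) (input output : Tree) (t : ℕ) : Prop :=
  ∃ σ : Store, Exec p (initStore input) σ t ∧ σ 0 = output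

/-! ### Encoding of instances and of lists of vertex sets -/

/-- A bit as a tree. -/
def encodeBool : Bool → Tree
  | false => Tree.nil
  | true => Tree.cons Tree.nil Tree.nil

/-- A list as a right comb of the encodings of its members. -/
def encodeList {α : Type*} (enc : α → Tree) : List α → Tree
  | [] => Tree.nil
  | a :: l => Tree.cons (enc a) (encodeList enc l)

/-- A natural number in binary, least significant bit first. -/
def encodeNat (k : ℕ) : Tree :=
  encodeList encodeBool k.bits

open Classical in
/-- A vertex set of an `n`-vertex graph as its characteristic vector of `n` bits. -/
noncomputable def encodeVertexSet {n : ℕ} (S : Finset (Fin n)) : Tree :=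
  encodeList encodeBool (List.ofFn fun i : Fin n => decide (i ∈ S))

open Classical in
/-- A graph as its adjacency matrix, row by row. -/
noncomputable def encodeGraph {n : ℕ} (G : SimpleGraph (Fin n)) : Tree :=
  encodeList (encodeList encodeBool)
    (List.ofFn fun i : Fin n => List.ofFn fun j : Fin n => decide (G.Adj i j))

/-- The instance `(G, k)` as an input tree. -/
noncomputable def encodeInstance {n : ℕ} (G : SimpleGraph (Fin n)) (k : ℕ) : Tree :=
  Tree.cons (encodeGraph G) (encodeNat k)

end FillIn

/-! Potential maximal cliques are recognizable in polynomial time: by the theorem of Bouchitté and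
Todinca (`isPotentialMaximalClique_iff`), `Ω` is one exactly if no component of `G - Ω` is attached
to all of `Ω` and any two nonadjacent vertices of `Ω` are attached to a common component. So it
suffices to produce `n ^ O(√k)` candidates that include every quasi-clique, to test them and to
remove duplicates.

Candidates come from `exists_eq_pickSet`. Let `X = Ω \ Z` be a clique with `Z` small. Guess `Z`, or
`Z` minus one vertex `z`, among the `n ^ O(√k)` small sets, delete all edges at the guessed set, and
triangulate the rest by a fixed polynomial procedure that creates no edge across a clique separator
(`isSafeTriangulation_foldl`). If some component of `G - Ω` is attached to all of `X`, then `X`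
separates it from the vertex `z` that it misses, and `X` is the common neighbourhood of one vertex
from either side (`eq_pickSet_of_full`). Otherwise a component with the most neighbours in `X`
singles out `X` within a closed neighbourhood (`eq_pickSet_of_noFull`). Either way `Ω` is the
guessed set together with a set described by five vertices, or `Ω = Z`.

Chordality is used through `SimplicialAt`: outside every closed neighbourhood, each component has a
clique as its neighbourhood.

For the running time, functions on encoded data are shown to be computable in time polynomial in the
width of the input. Only the decoding of `k` and the list of small sets need the larger measure
`Alg.cost`, which `Alg.cost_le` bounds by `n ^ O(√k)`. -/

/-! ### Size and time on the tree machine -/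

namespace FillIn

/-! ### Width of trees -/

namespace Tree

/-- The length of the right spine. -/
def spine : Tree → ℕ
  | nil => 0
  | cons _ r => spine r + 1

/-- The maximal length of a right spine of a subtree. Unlike the number of nodes, it grows by at
most one in each unit of time. -/
def width : Tree → ℕ
  | nil => 0
  | cons l r => max (width l) (max (spine r + 1) (width r))

theorem spine_le_width (t : Tree) : t.spine ≤ t.width := by
  cases t <;> simp [spine, width]

theorem width_cons_le (l r : Tree) : (cons l r).width ≤ max l.width r.width + 1 := by
  have := spine_le_width r
  simp only [width]
  omega

theorem width_hd_le (t : Tree) : t.hd.width ≤ t.width := by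
  cases t <;> simp [hd, width]

theorem width_tl_le (t : Tree) : t.tl.width ≤ t.width := by
  cases t <;> simp [tl, width]

end Tree

theorem Expr.width_eval_le {σ : Store} {B : ℕ} (hσ : ∀ i, (σ i).width ≤ B) (e : Expr) :
    (e.eval σ).width ≤ B + e.cost := by
  induction e with
  | var x => exact (hσ x).trans (Nat.le_add_right _ _)
  | nil => simp [eval, Tree.width]
  | cons e f he hf =>
    have := Tree.width_cons_le (e.eval σ) (f.eval σ)
    simp only [eval, cost]
    omega
  | hd e he =>
    have := Tree.width_hd_le (e.eval σ)
    simp only [eval, cost]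
    omega
  | tl e he =>
    have := Tree.width_tl_le (e.eval σ)
    simp only [eval, cost]
    omega

/-- Evaluating `cons x x` doubles the number of nodes but raises the width by at most one. With
width as size, every time bound therefore also bounds the size of the output. -/
theorem Exec.width_le {p : Com} {σ σ' : Store} {t : ℕ} (h : Exec p σ σ' t) :
    ∀ {B : ℕ}, (∀ i, (σ i).width ≤ B) → ∀ i, (σ' i).width ≤ B + t := by
  induction h with
  | assign x e σ =>
    intro B hB i
    by_cases hi : i = x
    · subst hi
      simpa using (Expr.width_eval_le hB e).trans (by omega)
    · simpa [Function.update_of_ne hi] using (hB i).trans (by omega)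
  | seq _ _ h₁ h₂ => intro B hB i; exact (h₂ (h₁ hB) i).trans (by omega)
  | ite_true _ _ h => intro B hB i; exact (h hB i).trans (by omega)
  | ite_false _ _ h => intro B hB i; exact (h hB i).trans (by omega)
  | loop_stop _ => intro B hB i; exact (hB i).trans (by omega)
  | loop_step _ _ _ h₁ h₂ => intro B hB i; exact (h₂ (h₁ hB) i).trans (by omega)

/-! ### Encodings -/

/-- Types whose elements are encoded as trees. -/
class Enc (α : Type*) where
  enc : α → Tree

open Enc

instance : Enc Bool := ⟨encodeBool⟩

/-- Natural numbers are encoded in unary. -/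
instance : Enc ℕ := ⟨fun n => Nat.rec Tree.nil (fun _ t => Tree.cons Tree.nil t) n⟩

instance {α : Type*} [Enc α] : Enc (List α) := ⟨encodeList enc⟩

instance {α β : Type*} [Enc α] [Enc β] : Enc (α × β) := ⟨fun p => Tree.cons (enc p.1) (enc p.2)⟩

variable {α β γ δ : Type*} [Enc α] [Enc β] [Enc γ] [Enc δ]

/-- The width of the encoding. -/
def wd (x : α) : ℕ := (enc x).width

theorem spine_enc_list (l : List α) : (enc l).spine = l.length := by
  induction l with
  | nil => rfl
  | cons a l ih =>
    rw [List.length_cons, ← ih]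
    rfl

theorem wd_cons (a : α) (l : List α) : wd (a :: l) = max (wd a) (max (l.length + 1) (wd l)) := by
  rw [← spine_enc_list]
  rfl

theorem wd_list_le {l : List α} {B : ℕ} : wd l ≤ B ↔ l.length ≤ B ∧ ∀ a ∈ l, wd a ≤ B := by
  induction l with
  | nil =>
    have : wd ([] : List α) = 0 := rfl
    simp [this]
  | cons a l ih =>
    simp only [wd_cons, max_le_iff, ih, List.length_cons, List.mem_cons, forall_eq_or_imp]
    constructor
    · tauto
    · rintro ⟨h₁, h₂, h₃⟩
      exact ⟨h₂, h₁, by omega, h₃⟩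

theorem length_le_wd (l : List α) : l.length ≤ wd l := (wd_list_le.1 le_rfl).1

theorem wd_le_of_mem {l : List α} {a : α} (h : a ∈ l) : wd a ≤ wd l := (wd_list_le.1 le_rfl).2 a h

theorem wd_nat (n : ℕ) : wd n = n := by
  have hs : ∀ n : ℕ, (enc n).spine = n := by
    intro n
    induction n with
    | zero => rfl
    | succ n ih => exact congrArg (· + 1) ih
  induction n with
  | zero => rfl
  | succ n ih =>
    change max 0 (max ((enc n).spine + 1) (wd n)) = n + 1
    rw [hs, ih]
    omega

theorem wd_bool (b : Bool) : wd b ≤ 1 := by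
  cases b <;> decide

theorem wd_prod_le (x : α × β) : wd x ≤ max (wd x.1) (wd x.2) + 1 :=
  Tree.width_cons_le _ _

theorem wd_fst_le (x : α × β) : wd x.1 ≤ wd x := Tree.width_hd_le (enc x)

/-! ### Polynomial bounds -/

/-- `f` is bounded by a polynomial in `μ`. -/
def PolyBdd {α : Type*} (μ f : α → ℕ) : Prop := ∃ d, ∀ x, f x ≤ (μ x + 2) ^ d

namespace PolyBdd

variable {α β : Type*} {μ f g : α → ℕ}

theorem mono (hg : PolyBdd μ g) (h : ∀ x, f x ≤ g x) : PolyBdd μ f :=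
  let ⟨d, hd⟩ := hg
  ⟨d, fun x => (h x).trans (hd x)⟩

theorem self (μ : α → ℕ) : PolyBdd μ μ := ⟨1, fun x => by simp⟩

theorem const (c : ℕ) : PolyBdd μ (fun _ => c) :=
  ⟨c, fun x => c.lt_two_pow_self.le.trans (Nat.pow_le_pow_left (by omega) c)⟩

theorem mul (hf : PolyBdd μ f) (hg : PolyBdd μ g) : PolyBdd μ (fun x => f x * g x) := by
  obtain ⟨d, hd⟩ := hf
  obtain ⟨e, he⟩ := hg
  exact ⟨d + e, fun x => (Nat.mul_le_mul (hd x) (he x)).trans (pow_add _ _ _).ge⟩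

theorem add (hf : PolyBdd μ f) (hg : PolyBdd μ g) : PolyBdd μ (fun x => f x + g x) := by
  obtain ⟨d, hd⟩ := hf
  obtain ⟨e, he⟩ := hg
  refine ⟨d + e + 1, fun x => ?_⟩
  have h₁ : (μ x + 2) ^ d ≤ (μ x + 2) ^ (d + e) := Nat.pow_le_pow_right (by omega) (by omega)
  have h₂ : (μ x + 2) ^ e ≤ (μ x + 2) ^ (d + e) := Nat.pow_le_pow_right (by omega) (by omega)
  have h₃ := Nat.mul_le_mul_left ((μ x + 2) ^ (d + e)) (show 2 ≤ μ x + 2 by omega)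
  have := hd x
  have := he x
  rw [pow_succ]
  dsimp only
  omega

theorem pow (hf : PolyBdd μ f) (d : ℕ) : PolyBdd μ (fun x => f x ^ d) := by
  obtain ⟨e, he⟩ := hf
  exact ⟨e * d, fun x => (Nat.pow_le_pow_left (he x) d).trans (pow_mul _ _ _).ge⟩

theorem max (hf : PolyBdd μ f) (hg : PolyBdd μ g) : PolyBdd μ (fun x => Max.max (f x) (g x)) :=
  (hf.add hg).mono fun x => by omega

theorem trans {ν : α → ℕ} (hf : PolyBdd ν f) (hν : PolyBdd μ ν) : PolyBdd μ f := by
  obtain ⟨d, hd⟩ := hf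
  exact ((hν.add (const 2)).pow d).mono hd

theorem comp (hf : PolyBdd μ f) (k : β → α) : PolyBdd (fun x => μ (k x)) (fun x => f (k x)) :=
  let ⟨d, hd⟩ := hf
  ⟨d, fun x => hd (k x)⟩

end PolyBdd

/-! ### Functions computed in bounded time -/

/-- `p` computes `F` in time `T`, with input and output in register `r`, and without changing the
registers below `r`. -/
def ComputesAt (p : Com) (r : ℕ) (F : α → β) (T : α → ℕ) : Prop :=
  ∀ (σ : Store) (x : α), σ r = enc x → ∃ (σ' : Store) (t : ℕ),
    Exec p σ σ' t ∧ σ' r = enc (F x) ∧ (∀ j < r, σ' j = σ j) ∧ t ≤ T x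

/-- `F` is computed in time polynomial in `μ`. -/
def Timed (μ : α → ℕ) (F : α → β) : Prop :=
  -- `T` is chosen before the register, so programs can be relocated without changing the bound.
  -- Nothing is assumed about the registers above `r`, which are scratch space.
  ∃ T, PolyBdd μ T ∧ ∀ r, ∃ p, ComputesAt p r F T

/-- `F` is computed in time polynomial in the width of the input. -/
@[fun_prop]
def PTime (F : α → β) : Prop := Timed wd F

theorem Timed.mono {μ ν : α → ℕ} {F : α → β} (h : Timed μ F) (hμ : PolyBdd ν μ) : Timed ν F :=
  let ⟨T, hT, hp⟩ := h
  ⟨T, hT.trans hμ, hp⟩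

theorem PTime.timed {μ : α → ℕ} {F : α → β} (h : PTime F) (hμ : PolyBdd μ wd) : Timed μ F :=
  Timed.mono h hμ

theorem ComputesAt.wd_le {p : Com} {r : ℕ} {F : α → β} {T : α → ℕ} (h : ComputesAt p r F T)
    (x : α) : wd (F x) ≤ wd x + T x := by
  obtain ⟨σ', t, he, hr, -, ht⟩ := h (Function.update (fun _ => Tree.nil) r (enc x)) x (by simp)
  have hB : ∀ i, (Function.update (fun _ => Tree.nil) r (enc x) i).width ≤ wd x := by
    intro i
    by_cases hi : i = r
    · subst hi; simp [wd]
    · simp [Function.update_of_ne hi, Tree.width]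
  have := he.width_le hB r
  rw [hr] at this
  exact this.trans (by omega)

theorem Timed.wd_bdd {μ : α → ℕ} {F : α → β} (h : Timed μ F) (hμ : PolyBdd μ wd) :
    PolyBdd μ (fun x => wd (F x)) := by
  obtain ⟨T, hT, hp⟩ := h
  obtain ⟨p, hp⟩ := hp 0
  exact (hμ.add hT).mono hp.wd_le

theorem PTime.wd_bdd {F : α → β} (h : PTime F) : PolyBdd wd (fun x => wd (F x)) :=
  Timed.wd_bdd h (PolyBdd.self _)

theorem PTime.of_expr (F : α → β) (e : ℕ → Expr) (c : ℕ) (hc : ∀ r, (e r).cost ≤ c)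
    (he : ∀ r (σ : Store) x, σ r = enc x → (e r).eval σ = enc (F x)) : PTime F := by
  refine ⟨fun _ => c + 1, PolyBdd.const _, fun r => ⟨Com.assign r (e r), fun σ x hx => ?_⟩⟩
  refine ⟨_, _, Exec.assign _ _ _, by simpa using he r σ x hx, fun j hj => ?_, ?_⟩
  · exact Function.update_of_ne hj.ne _ _
  · exact Nat.succ_le_succ (hc r)

theorem PTime.of_enc_eq (F : α → β) (h : ∀ x, enc (F x) = enc x) : PTime F :=
  PTime.of_expr F Expr.var 1 (fun _ => le_rfl) fun _ _ x hx => hx.trans (h x).symm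

/-- The outer program is polynomial in the width of the intermediate value, which is itself bounded
by the input width plus the time spent on producing it. -/
theorem Timed.comp' {μ : α → ℕ} {G : β → γ} {F : α → β} (hG : PTime G) (hF : Timed μ F)
    (hμ : PolyBdd μ wd) : Timed μ (fun x => G (F x)) := by
  have hb := hF.wd_bdd hμ
  obtain ⟨S, hS, hq⟩ := hG
  obtain ⟨T, hT, hp⟩ := hF
  refine ⟨fun x => T x + S (F x), hT.add ((hS.comp F).trans hb), fun r => ?_⟩
  obtain ⟨p, hp⟩ := hp r
  obtain ⟨q, hq⟩ := hq r
  refine ⟨Com.seq p q, fun σ x hx => ?_⟩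
  obtain ⟨σ₁, t₁, e₁, r₁, f₁, b₁⟩ := hp σ x hx
  obtain ⟨σ₂, t₂, e₂, r₂, f₂, b₂⟩ := hq σ₁ _ r₁
  exact ⟨σ₂, _, Exec.seq e₁ e₂, r₂, fun j hj => (f₂ j hj).trans (f₁ j hj), add_le_add b₁ b₂⟩

theorem Timed.prodMk {μ : α → ℕ} {F : α → β} {G : α → γ} (hF : Timed μ F) (hG : Timed μ G) :
    Timed μ (fun x => (F x, G x)) := by
  obtain ⟨T, hT, hp⟩ := hF
  obtain ⟨S, hS, hq⟩ := hG
  refine ⟨fun x => T x + S x + 8, (hT.add hS).add (PolyBdd.const 8), fun r => ?_⟩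
  -- The programs run on copies of the input in `r + 1` and `r + 2`: the first cannot touch the
  -- input in `r`, the second cannot touch the first result.
  obtain ⟨p, hp⟩ := hp (r + 1)
  obtain ⟨q, hq⟩ := hq (r + 2)
  refine ⟨Com.seq (Com.assign (r + 1) (Expr.var r)) (Com.seq p
    (Com.seq (Com.assign (r + 2) (Expr.var r)) (Com.seq q
    (Com.assign r (Expr.cons (Expr.var (r + 1)) (Expr.var (r + 2))))))), fun σ x hx => ?_⟩
  obtain ⟨σ₁, t₁, e₁, r₁, f₁, b₁⟩ := hp (Function.update σ (r + 1) (σ r)) x (by simpa using hx)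
  have hr : σ₁ r = enc x := by
    rw [f₁ r (by omega), Function.update_of_ne (by omega), hx]
  obtain ⟨σ₂, t₂, e₂, r₂, f₂, b₂⟩ := hq (Function.update σ₁ (r + 2) (σ₁ r)) x (by simpa using hr)
  refine ⟨_, _, Exec.seq (Exec.assign _ _ _) (Exec.seq e₁ (Exec.seq (Exec.assign _ _ _)
    (Exec.seq e₂ (Exec.assign _ _ _)))), ?_, fun j hj => ?_, ?_⟩
  · simp only [Function.update_self, Expr.eval, r₂]
    rw [f₂ (r + 1) (by omega), Function.update_of_ne (by omega), r₁]
    rfl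
  · rw [Function.update_of_ne (by omega), f₂ j (by omega), Function.update_of_ne (by omega),
      f₁ j (by omega), Function.update_of_ne (by omega)]
  · simp only [Expr.cost]
    omega

theorem Timed.cond {μ : α → ℕ} {b : α → Bool} {F G : α → β} (hb : Timed μ b) (hF : Timed μ F)
    (hG : Timed μ G) : Timed μ (fun x => bif b x then F x else G x) := by
  obtain ⟨R, hR, hs⟩ := hb
  obtain ⟨T, hT, hp⟩ := hF
  obtain ⟨S, hS, hq⟩ := hG
  refine ⟨fun x => R x + (T x + S x) + 4, (hR.add (hT.add hS)).add (PolyBdd.const 4), fun r => ?_⟩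
  obtain ⟨s, hs⟩ := hs (r + 1)
  obtain ⟨p, hp⟩ := hp r
  obtain ⟨q, hq⟩ := hq r
  refine ⟨Com.seq (Com.assign (r + 1) (Expr.var r)) (Com.seq s
    (Com.ite (Expr.var (r + 1)) p q)), fun σ x hx => ?_⟩
  obtain ⟨σ₁, t₁, e₁, r₁, f₁, b₁⟩ := hs (Function.update σ (r + 1) (σ r)) x (by simpa using hx)
  have hr : σ₁ r = enc x := by
    rw [f₁ r (by omega), Function.update_of_ne (by omega), hx]
  have hlow : ∀ j < r, σ₁ j = σ j := fun j hj => by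
    rw [f₁ j (by omega), Function.update_of_ne (by omega)]
  cases hbx : b x with
  | true =>
    obtain ⟨σ₂, t₂, e₂, r₂, f₂, b₂⟩ := hp σ₁ x hr
    refine ⟨_, _, Exec.seq (Exec.assign _ _ _) (Exec.seq e₁ (Exec.ite_true ?_ e₂)), ?_,
      fun j hj => (f₂ j hj).trans (hlow j hj), ?_⟩
    · rw [Expr.eval, r₁, hbx]
      exact nofun
    · simpa [hbx] using r₂
    · simp only [Expr.cost]
      omega
  | false =>
    obtain ⟨σ₂, t₂, e₂, r₂, f₂, b₂⟩ := hq σ₁ x hr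
    refine ⟨_, _, Exec.seq (Exec.assign _ _ _) (Exec.seq e₁ (Exec.ite_false ?_ e₂)), ?_,
      fun j hj => (f₂ j hj).trans (hlow j hj), ?_⟩
    · rw [Expr.eval, r₁, hbx]
      rfl
    · simpa [hbx] using r₂
    · simp only [Expr.cost]
      omega

/-- The body of the loop that folds over a list: the context is in register `r`, the accumulator in
`r + 1`, the list in `r + 2`. -/
def foldBody (r : ℕ) (s : Com) : Com :=
  Com.seq (Com.assign (r + 3) (Expr.cons (Expr.var r)
    (Expr.cons (Expr.var (r + 1)) (Expr.hd (Expr.var (r + 2))))))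
  (Com.seq s (Com.seq (Com.assign (r + 1) (Expr.var (r + 3)))
    (Com.assign (r + 2) (Expr.tl (Expr.var (r + 2))))))

/-- The bound `C` is only demanded for accumulators that really occur, those of prefixes of `l`. One
round costs 2 for the test, 7 for packing the argument and 2 + 3 for the two updates, hence 14. -/
theorem exec_fold {f : α → β → γ → β} {T : α × β × γ → ℕ} {r : ℕ} {s : Com}
    (hs : ComputesAt s (r + 3) (fun p : α × β × γ => f p.1 p.2.1 p.2.2) T) (x : α) (C : ℕ)
    (l : List γ) : ∀ (σ : Store) (a : β), σ r = enc x → σ (r + 1) = enc a → σ (r + 2) = enc l →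
      (∀ l' c, l' ++ [c] <+: l → T (x, l'.foldl (f x) a, c) ≤ C) →
      ∃ σ' t, Exec (Com.loop (Expr.var (r + 2)) (foldBody r s)) σ σ' t ∧
        σ' (r + 1) = enc (l.foldl (f x) a) ∧ (∀ j < r, σ' j = σ j) ∧
        t ≤ l.length * (C + 14) + 2 := by
  induction l with
  | nil =>
    intro σ a _ h₁ h₂ _
    exact ⟨σ, _, Exec.loop_stop (by rw [Expr.eval, h₂]; rfl), by simpa using h₁, fun _ _ => rfl,
      by simp [Expr.cost]⟩
  | cons c l ih =>
    intro σ a h₀ h₁ h₂ hT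
    obtain ⟨σ₁, t₁, e₁, r₁, f₁, b₁⟩ := hs (Function.update σ (r + 3) (Tree.cons (σ r)
      (Tree.cons (σ (r + 1)) (σ (r + 2)).hd))) (x, a, c) (by rw [h₀, h₁, h₂]; simp; rfl)
    have g : ∀ j < r + 3, σ₁ j = σ j := fun j hj => by
      rw [f₁ j hj, Function.update_of_ne (by omega)]
    have hb : T (x, a, c) ≤ C := hT [] c (by simp)
    set σ₂ := Function.update (Function.update σ₁ (r + 1) (σ₁ (r + 3))) (r + 2) (σ₁ (r + 2)).tl
      with hσ₂
    have hbody : Exec (foldBody r s) σ σ₂ (6 + 1 + (t₁ + (1 + 1 + (2 + 1)))) := by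
      have hu : (σ₁ (r + 2)).tl = (Expr.tl (Expr.var (r + 2))).eval
          (Function.update σ₁ (r + 1) (σ₁ (r + 3))) := by
        simp [Expr.eval]
      rw [hσ₂, hu]
      exact Exec.seq (Exec.assign _ _ _) (Exec.seq e₁ (Exec.seq (Exec.assign _ _ _)
        (Exec.assign _ _ _)))
    obtain ⟨σ₃, t₃, e₃, r₃, f₃, b₃⟩ := ih σ₂ (f x a c)
      (by simp [hσ₂, g r (by omega), h₀])
      (by simp [hσ₂, r₁])
      (by simp [hσ₂, g (r + 2) (by omega), h₂]; rfl)
      (fun l' c' h => by simpa using hT (c :: l') c' (by simpa using h))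
    refine ⟨σ₃, _, Exec.loop_step ?_ hbody e₃, by simpa using r₃, fun j hj => ?_, ?_⟩
    · rw [Expr.eval, h₂]
      exact nofun
    · rw [f₃ j hj, hσ₂, Function.update_of_ne (by omega), Function.update_of_ne (by omega),
        g j (by omega)]
    · simp only [Expr.cost, List.length_cons, add_mul]
      change t₁ ≤ _ at b₁
      omega

/-- Iterating a polynomial-time step may blow up the accumulator, so a bound `B` on all intermediate
accumulators has to be supplied. -/
theorem Timed.foldl {μ : α → ℕ} {L : α → List γ} {i : α → β} {f : α → β → γ → β}
    (hμ : PolyBdd μ wd) (hL : Timed μ L) (hi : Timed μ i)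
    (hf : PTime (fun p : α × β × γ => f p.1 p.2.1 p.2.2)) (B : α → ℕ) (hB : PolyBdd μ B)
    (hacc : ∀ x l, l <+: L x → wd (l.foldl (f x) (i x)) ≤ B x) :
    Timed μ (fun x => (L x).foldl (f x) (i x)) := by
  have hLw := hL.wd_bdd hμ
  obtain ⟨R, ⟨d, hR⟩, hs⟩ := hf
  obtain ⟨T, hT, hp⟩ := hL
  obtain ⟨S, hS, hq⟩ := hi
  -- The first 2 pays for the two `cons` cells of the triple, the second is the offset in `PolyBdd`.
  set C : α → ℕ := fun x => (wd x + (B x + wd (L x)) + 2 + 2) ^ d with hC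
  have hCb : PolyBdd μ C :=
    (((hμ.add (hB.add hLw)).add (PolyBdd.const 2)).add (PolyBdd.const 2)).pow d
  refine ⟨fun x => T x + S x + (wd (L x) * (C x + 14) + 2) + 6, ((hT.add hS).add
    ((hLw.mul (hCb.add (PolyBdd.const _))).add (PolyBdd.const _))).add (PolyBdd.const _),
    fun r => ?_⟩
  obtain ⟨p, hp⟩ := hp (r + 2)
  obtain ⟨q, hq⟩ := hq (r + 1)
  obtain ⟨s, hs⟩ := hs (r + 3)
  refine ⟨Com.seq (Com.assign (r + 1) (Expr.var r)) (Com.seq q (Com.seq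
    (Com.assign (r + 2) (Expr.var r)) (Com.seq p (Com.seq
    (Com.loop (Expr.var (r + 2)) (foldBody r s)) (Com.assign r (Expr.var (r + 1))))))),
    fun σ x hx => ?_⟩
  obtain ⟨σ₁, t₁, e₁, r₁, f₁, b₁⟩ := hq (Function.update σ (r + 1) (σ r)) x (by simpa using hx)
  have hr : σ₁ r = enc x := by
    rw [f₁ r (by omega), Function.update_of_ne (by omega), hx]
  obtain ⟨σ₂, t₂, e₂, r₂, f₂, b₂⟩ := hp (Function.update σ₁ (r + 2) (σ₁ r)) x (by simpa using hr)
  obtain ⟨σ₃, t₃, e₃, r₃, f₃, b₃⟩ := exec_fold hs x (C x) (L x) σ₂ (i x)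
    (by rw [f₂ r (by omega), Function.update_of_ne (by omega), hr])
    (by rw [f₂ (r + 1) (by omega), Function.update_of_ne (by omega), r₁]) r₂
    (fun l' c h => by
      refine (hR _).trans (Nat.pow_le_pow_left ?_ d)
      have h₁ := hacc x l' ((List.prefix_append _ _).trans h)
      have h₂ : wd c ≤ wd (L x) := wd_le_of_mem (h.subset (by simp))
      have h₃ := wd_prod_le (x, l'.foldl (f x) (i x), c)
      have h₄ := wd_prod_le (l'.foldl (f x) (i x), c)
      dsimp only at h₃ h₄
      omega)
  refine ⟨_, _, Exec.seq (Exec.assign _ _ _) (Exec.seq e₁ (Exec.seq (Exec.assign _ _ _)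
    (Exec.seq e₂ (Exec.seq e₃ (Exec.assign _ _ _))))), ?_, fun j hj => ?_, ?_⟩
  · simpa [Expr.eval] using r₃
  · rw [Function.update_of_ne (by omega), f₃ j (by omega), f₂ j (by omega),
      Function.update_of_ne (by omega), f₁ j (by omega), Function.update_of_ne (by omega)]
  · have : (L x).length * (C x + 14) ≤ wd (L x) * (C x + 14) :=
      Nat.mul_le_mul_right _ (length_le_wd _)
    simp only [Expr.cost]
    omega

end FillIn

/-! ### A library of polynomial-time functions on lists and unary numbers -/

namespace FillIn

open Enc

variable {α β γ δ : Type*} [Enc α] [Enc β] [Enc γ] [Enc δ]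

/-! ### Closure properties of polynomial time -/

namespace PTime

@[fun_prop]
theorem id : PTime (fun x : α => x) := of_enc_eq _ fun _ => rfl

@[fun_prop]
theorem const (b : β) : PTime (fun _ : α => b) := by
  let quote : Tree → Expr := fun t => Tree.rec Expr.nil (fun _ _ e f => Expr.cons e f) t
  refine of_expr _ (fun _ => quote (enc b)) _ (fun _ => le_rfl) fun r σ x _ => ?_
  generalize enc b = t
  induction t with
  | nil => rfl
  | cons l r hl hr => exact congrArg₂ Tree.cons hl hr

@[fun_prop]
theorem comp {G : β → γ} {F : α → β} (hG : PTime G) (hF : PTime F) : PTime (fun x => G (F x)) :=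
  Timed.comp' hG hF (PolyBdd.self _)

@[fun_prop]
theorem prodMk {F : α → β} {G : α → γ} (hF : PTime F) (hG : PTime G) :
    PTime (fun x => (F x, G x)) :=
  Timed.prodMk hF hG

@[fun_prop]
theorem fst : PTime (fun x : α × β => x.1) :=
  of_expr _ (fun r => Expr.hd (Expr.var r)) 2 (fun _ => le_rfl) fun _ _ _ h => by
    rw [Expr.eval, Expr.eval, h]
    rfl

@[fun_prop]
theorem snd : PTime (fun x : α × β => x.2) :=
  of_expr _ (fun r => Expr.tl (Expr.var r)) 2 (fun _ => le_rfl) fun _ _ _ h => by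
    rw [Expr.eval, Expr.eval, h]
    rfl

@[fun_prop]
theorem cond {b : α → Bool} {F G : α → β} (hb : PTime b) (hF : PTime F) (hG : PTime G) :
    PTime (fun x => bif b x then F x else G x) :=
  Timed.cond hb hF hG

@[fun_prop]
theorem and {b c : α → Bool} (hb : PTime b) (hc : PTime c) : PTime (fun x => b x && c x) := by
  have : (fun x => b x && c x) = fun x => bif b x then c x else false := by
    funext x; cases b x <;> rfl
  rw [this]
  fun_prop

@[fun_prop]
theorem or {b c : α → Bool} (hb : PTime b) (hc : PTime c) : PTime (fun x => b x || c x) := by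
  have : (fun x => b x || c x) = fun x => bif b x then true else c x := by
    funext x; cases b x <;> rfl
  rw [this]
  fun_prop

@[fun_prop]
theorem not {b : α → Bool} (hb : PTime b) : PTime (fun x => !b x) := by
  have : (fun x => !b x) = fun x => bif b x then false else true := by
    funext x; cases b x <;> rfl
  rw [this]
  fun_prop

@[fun_prop]
theorem boolBEq {b c : α → Bool} (hb : PTime b) (hc : PTime c) : PTime (fun x => b x == c x) := by
  have : (fun x => b x == c x) = fun x => bif b x then c x else !c x := by
    funext x; cases b x <;> cases c x <;> rfl
  rw [this]
  fun_prop

/-! #### Lists -/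

theorem cons' : PTime (fun x : α × List α => x.1 :: x.2) := of_enc_eq _ fun _ => rfl

@[fun_prop]
theorem cons {F : α → β} {L : α → List β} (hF : PTime F) (hL : PTime L) :
    PTime (fun x => F x :: L x) :=
  cons'.comp (hF.prodMk hL)

theorem tail' : PTime (fun x : List α => x.tail) :=
  of_expr _ (fun r => Expr.tl (Expr.var r)) 2 (fun _ => le_rfl) fun _ _ x h => by
    rw [Expr.eval, Expr.eval, h]
    cases x <;> rfl

@[fun_prop]
theorem tail {L : α → List β} (hL : PTime L) : PTime (fun x => (L x).tail) :=
  tail'.comp hL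

/-- `foldl` with accumulators of polynomially bounded width. -/
theorem foldl {L : α → List γ} {i : α → β} {f : α → β → γ → β} (hL : PTime L) (hi : PTime i)
    (hf : PTime (fun p : α × β × γ => f p.1 p.2.1 p.2.2)) (B : α → ℕ) (hB : PolyBdd wd B)
    (hacc : ∀ x l, l <+: L x → wd (l.foldl (f x) (i x)) ≤ B x) :
    PTime (fun x => (L x).foldl (f x) (i x)) :=
  Timed.foldl (PolyBdd.self _) hL hi hf B hB hacc

/-- `foldl` with accumulators whose width depends on the context only. -/
theorem foldl_of_wd_le {L : α → List γ} {i : α → β} {f : α → β → γ → β} (hL : PTime L)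
    (hi : PTime i) (hf : PTime (fun p : α × β × γ => f p.1 p.2.1 p.2.2)) (B : α → ℕ)
    (hB : PolyBdd wd B) (hf' : ∀ x b c, wd (f x b c) ≤ B x) :
    PTime (fun x => (L x).foldl (f x) (i x)) := by
  refine foldl hL hi hf (fun x => max (wd (i x)) (B x)) (hi.wd_bdd.max hB) fun x l _ => ?_
  induction l using List.reverseRecOn with
  | nil => exact le_max_left _ _
  | append_singleton l c _ =>
    rw [List.foldl_append]
    exact (hf' _ _ _).trans (le_max_right _ _)

@[fun_prop]
theorem foldl_bool {L : α → List γ} {i : α → Bool} {f : α → Bool → γ → Bool} (hL : PTime L)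
    (hi : PTime i) (hf : PTime (fun p : α × Bool × γ => f p.1 p.2.1 p.2.2)) :
    PTime (fun x => (L x).foldl (f x) (i x)) :=
  foldl_of_wd_le hL hi hf _ (PolyBdd.const 1) fun _ _ _ => wd_bool _

@[fun_prop]
theorem any {L : α → List γ} {f : α → γ → Bool} (hL : PTime L)
    (hf : PTime (fun p : α × γ => f p.1 p.2)) : PTime (fun x => (L x).any (f x)) := by
  have : (fun x => (L x).any (f x)) = fun x => (L x).foldl (fun b c => b || f x c) false := by
    funext x
    have : ∀ b, (L x).foldl (fun b c => b || f x c) b = (b || (L x).any (f x)) := by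
      induction L x with
      | nil => simp
      | cons a l ih => intro b; simp [ih, Bool.or_assoc]
    simp [this]
  rw [this]
  have : PTime (fun p : α × Bool × γ => f p.1 p.2.2) :=
    hf.comp (F := fun p : α × Bool × γ => (p.1, p.2.2)) (by fun_prop)
  fun_prop

@[fun_prop]
theorem all {L : α → List γ} {f : α → γ → Bool} (hL : PTime L)
    (hf : PTime (fun p : α × γ => f p.1 p.2)) : PTime (fun x => (L x).all (f x)) := by
  have : (fun x => (L x).all (f x)) = fun x => !(L x).any (fun c => !f x c) := by
    funext x
    rw [List.any_eq_not_all_not]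
    simp
  rw [this]
  fun_prop

@[fun_prop]
theorem reverse {L : α → List β} (hL : PTime L) : PTime (fun x => (L x).reverse) := by
  have : (fun x => (L x).reverse) = fun x => (L x).foldl (fun acc c => c :: acc) [] := by
    funext x
    simp
  rw [this]
  refine foldl hL (const _) (f := fun _ acc c => c :: acc) (by fun_prop) _ hL.wd_bdd
    fun x l hl => ?_
  have h := wd_list_le.1 (le_refl (wd (L x)))
  simp only [List.foldl_flip_cons_eq_append', List.append_nil, wd_list_le, List.length_reverse,
    List.mem_reverse]
  exact ⟨hl.length_le.trans h.1, fun a ha => h.2 a (hl.subset ha)⟩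

@[fun_prop]
theorem map {L : α → List γ} {f : α → γ → δ} (hL : PTime L)
    (hf : PTime (fun p : α × γ => f p.1 p.2)) : PTime (fun x => (L x).map (f x)) := by
  have key : ∀ x (l : List γ), l.foldl (fun acc c => f x c :: acc) [] = (l.map (f x)).reverse := by
    intro x l
    induction l using List.reverseRecOn with
    | nil => rfl
    | append_singleton l c ih => simp [ih]
  have : (fun x => (L x).map (f x)) =
      fun x => ((L x).foldl (fun acc c => f x c :: acc) []).reverse := by
    funext x
    rw [key, List.reverse_reverse]
  rw [this]
  refine reverse ?_
  obtain ⟨d, hd⟩ := hf.wd_bdd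
  have hf' : PTime (fun p : α × List δ × γ => f p.1 p.2.2) :=
    hf.comp (F := fun p : α × List δ × γ => (p.1, p.2.2)) (by fun_prop)
  refine foldl hL (const _) (f := fun x acc c => f x c :: acc) (by fun_prop)
    (fun x => wd (L x) + (wd x + wd (L x) + 1 + 2) ^ d)
    (hL.wd_bdd.add (((((PolyBdd.self _).add hL.wd_bdd).add (PolyBdd.const 1)).add
      (PolyBdd.const 2)).pow d)) fun x l hl => ?_
  rw [key, wd_list_le]
  have h := wd_list_le.1 (le_refl (wd (L x)))
  simp only [List.length_reverse, List.length_map, List.mem_reverse, List.mem_map]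
  refine ⟨(hl.length_le.trans h.1).trans (Nat.le_add_right _ _), ?_⟩
  rintro _ ⟨c, hc, rfl⟩
  refine (hd (x, c)).trans ((Nat.pow_le_pow_left ?_ d).trans (Nat.le_add_left _ _))
  have h₁ := wd_prod_le (x, c)
  have h₂ := h.2 c (hl.subset hc)
  dsimp only at h₁
  omega

@[fun_prop]
theorem append {L M : α → List β} (hL : PTime L) (hM : PTime M) :
    PTime (fun x => L x ++ M x) := by
  have : (fun x => L x ++ M x) = fun x => (L x).reverse.foldl (fun acc c => c :: acc) (M x) := by
    funext x
    simp
  rw [this]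
  refine foldl hL.reverse hM (f := fun _ acc c => c :: acc) (by fun_prop)
    _ (hL.wd_bdd.add hM.wd_bdd) fun x l hl => ?_
  have h := wd_list_le.1 (le_refl (wd (L x)))
  have h' := wd_list_le.1 (le_refl (wd (M x)))
  have hlen := hl.length_le
  rw [List.length_reverse] at hlen
  simp only [List.foldl_flip_cons_eq_append', wd_list_le, List.length_append, List.length_reverse,
    List.mem_append, List.mem_reverse]
  refine ⟨by omega, ?_⟩
  rintro a (ha | ha)
  · exact (h.2 a (by simpa using hl.subset ha)).trans (by omega)
  · exact (h'.2 a ha).trans (by omega)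

theorem length_flatten_le (l : List (List α)) : l.flatten.length ≤ wd l * wd l := by
  rw [List.length_flatten]
  have h : ∀ n ∈ l.map List.length, n ≤ wd l := by
    simp only [List.mem_map]
    rintro _ ⟨a, ha, rfl⟩
    exact (length_le_wd a).trans (wd_le_of_mem ha)
  have := List.sum_le_card_nsmul _ _ h
  simp only [List.length_map, smul_eq_mul] at this
  exact this.trans (Nat.mul_le_mul_right _ (length_le_wd l))

@[fun_prop]
theorem flatten {L : α → List (List β)} (hL : PTime L) : PTime (fun x => (L x).flatten) := by
  have key : ∀ l : List (List β), l.foldl (fun acc c => acc ++ c) [] = l.flatten := by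
    intro l
    induction l using List.reverseRecOn with
    | nil => rfl
    | append_singleton l c ih => simp [ih]
  have : (fun x => (L x).flatten) = fun x => (L x).foldl (fun acc c => acc ++ c) [] := by
    funext x
    rw [key]
  rw [this]
  refine foldl hL (const _) (f := fun _ acc c => acc ++ c) (by fun_prop)
    _ ((hL.wd_bdd.mul hL.wd_bdd).add hL.wd_bdd) fun x l hl => ?_
  have hlw : wd l ≤ wd (L x) := wd_list_le.2
    ⟨hl.length_le.trans (length_le_wd _), fun a ha => wd_le_of_mem (hl.subset ha)⟩
  rw [key, wd_list_le]
  refine ⟨(length_flatten_le l).trans ((Nat.mul_le_mul hlw hlw).trans (Nat.le_add_right _ _)),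
    fun a ha => ?_⟩
  obtain ⟨m, hm, ha⟩ := List.mem_flatten.1 ha
  exact (wd_le_of_mem ha).trans ((wd_le_of_mem hm).trans (hlw.trans (Nat.le_add_left _ _)))

@[fun_prop]
theorem flatMap {L : α → List γ} {f : α → γ → List δ} (hL : PTime L)
    (hf : PTime (fun p : α × γ => f p.1 p.2)) : PTime (fun x => (L x).flatMap (f x)) := by
  simp only [List.flatMap]
  fun_prop

@[fun_prop]
theorem filter {L : α → List γ} {f : α → γ → Bool} (hL : PTime L)
    (hf : PTime (fun p : α × γ => f p.1 p.2)) : PTime (fun x => (L x).filter (f x)) := by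
  have : (fun x => (L x).filter (f x)) =
      fun x => (L x).flatMap (fun c => bif f x c then [c] else []) := by
    funext x
    induction L x with
    | nil => rfl
    | cons a l ih => cases h : f x a <;> simp [h, ih]
  rw [this]
  fun_prop

/-! #### Unary numbers -/

/-- A unary number is the same tree as a list of `false`, so numbers and list lengths can be
converted by `map`. -/
theorem enc_length {ε : Type*} (l : List ε) : enc l.length = enc (l.map fun _ => false) := by
  induction l with
  | nil => rfl
  | cons a l ih => exact congrArg (Tree.cons Tree.nil) ih

theorem enc_replicate (n : ℕ) : enc (List.replicate n false) = enc n := by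
  induction n with
  | zero => rfl
  | succ n ih => exact congrArg (Tree.cons Tree.nil) ih

@[fun_prop]
theorem length {L : α → List β} (hL : PTime L) : PTime (fun x => (L x).length) := by
  have h : PTime (fun l : List Bool => l.length) := by
    obtain ⟨T, hT, hp⟩ := (map id (const false) : PTime fun l : List Bool => l.map fun _ => false)
    refine ⟨T, hT, fun r => (hp r).imp fun p hp σ x hx => ?_⟩
    rw [enc_length]
    exact hp σ x hx
  have := h.comp (map (f := fun _ _ => false) hL (const false))
  simpa using this

theorem replicate' : PTime (fun n : ℕ => List.replicate n false) := of_enc_eq _ enc_replicate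

@[fun_prop]
theorem range {N : α → ℕ} (hN : PTime N) : PTime (fun x => List.range (N x)) := by
  have key : ∀ l : List Bool, l.foldl (fun (acc : List ℕ) _ => acc ++ [acc.length]) [] =
      List.range l.length := by
    intro l
    induction l using List.reverseRecOn with
    | nil => rfl
    | append_singleton l c ih => simp [ih, List.range_succ]
  have h : PTime (fun l : List Bool => List.range l.length) := by
    simp only [← key]
    refine foldl id (const _) (f := fun (_ : List Bool) (acc : List ℕ) (_ : Bool) =>
      acc ++ [acc.length]) (by fun_prop)
      _ (PolyBdd.self wd) fun x l hl => ?_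
    rw [key, wd_list_le]
    have := hl.length_le.trans (length_le_wd x)
    simp only [List.length_range, List.mem_range, wd_nat]
    exact ⟨this, fun a ha => by omega⟩
  simpa using h.comp (replicate'.comp hN)

@[fun_prop]
theorem succ {N : α → ℕ} (hN : PTime N) : PTime (fun x => N x + 1) := by
  have h : PTime (fun n : ℕ => n + 1) :=
    of_expr _ (fun r => Expr.cons Expr.nil (Expr.var r)) 3 (fun _ => le_rfl) fun _ _ _ h => by
      rw [Expr.eval, Expr.eval, Expr.eval, h]
      rfl
  exact h.comp hN

theorem foldl_tail {ε : Type*} (n : ℕ) (l : List ε) :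
    (List.range n).foldl (fun acc _ => acc.tail) l = l.drop n := by
  induction n with
  | zero => rfl
  | succ n ih => rw [List.range_succ, List.foldl_append, ih]; simp

@[fun_prop]
theorem drop {N : α → ℕ} {L : α → List β} (hN : PTime N) (hL : PTime L) :
    PTime (fun x => (L x).drop (N x)) := by
  simp only [← foldl_tail]
  refine foldl (range hN) hL (f := fun _ acc _ => acc.tail) (by fun_prop) _ hL.wd_bdd
    fun x l hl => ?_
  obtain ⟨n, rfl⟩ : ∃ n, l = List.range n :=
    ⟨l.length, by
      have h₁ := List.prefix_iff_eq_take.1 hl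
      have h₂ := hl.length_le
      rw [List.take_range] at h₁
      simp only [List.length_range] at h₂
      rwa [min_eq_left h₂] at h₁⟩
  rw [foldl_tail, wd_list_le]
  exact ⟨by have := length_le_wd (L x); simp; omega,
    fun a ha => wd_le_of_mem (List.mem_of_mem_drop ha)⟩

/-- Reading a list, with a default value encoded by `nil`. -/
theorem getD_of_enc_eq_nil {N : α → ℕ} {L : α → List β} {d : β} (hd : enc d = Tree.nil)
    (hL : PTime L) (hN : PTime N) : PTime (fun x => (L x).getD (N x) d) := by
  -- The head of `nil` is `nil`, so reading past the end yields the default without a test.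
  have h : PTime (fun l : List β => l.headD d) :=
    of_expr _ (fun r => Expr.hd (Expr.var r)) 2 (fun _ => le_rfl) fun _ _ x h => by
      rw [Expr.eval, Expr.eval, h]
      cases x
      · exact hd.symm
      · rfl
  have := h.comp (drop hN hL)
  simpa [List.headD_eq_head?_getD, List.head?_drop, List.getD_eq_getElem?_getD] using this

@[fun_prop]
theorem getD_bool {N : α → ℕ} {L : α → List Bool} (hL : PTime L) (hN : PTime N) :
    PTime (fun x => (L x).getD (N x) false) :=
  getD_of_enc_eq_nil rfl hL hN

@[fun_prop]
theorem getD_list {N : α → ℕ} {L : α → List (List β)} (hL : PTime L) (hN : PTime N) :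
    PTime (fun x => (L x).getD (N x) []) :=
  getD_of_enc_eq_nil rfl hL hN

@[fun_prop]
theorem natBLE {M N : α → ℕ} (hM : PTime M) (hN : PTime N) :
    PTime (fun x => Nat.ble (M x) (N x)) := by
  -- A list of `M x` times `true` is exhausted by dropping `N x` members exactly if `M x ≤ N x`.
  have h : (fun x => Nat.ble (M x) (N x)) = fun x =>
      !(((List.range (M x)).map fun _ => true).drop (N x)).getD 0 false := by
    funext x
    rw [Bool.eq_iff_iff]
    simp [List.getD_eq_getElem?_getD]
    rcases Nat.eq_zero_or_pos (M x - N x) with h | h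
    · simp [h]
      omega
    · simp [h]
      omega
  rw [h]
  fun_prop

@[fun_prop]
theorem natBEq {M N : α → ℕ} (hM : PTime M) (hN : PTime N) : PTime (fun x => M x == N x) := by
  have : (fun x => M x == N x) = fun x => Nat.ble (M x) (N x) && Nat.ble (N x) (M x) := by
    funext x
    rw [Bool.eq_iff_iff]
    simp [Nat.ble_eq]
    omega
  rw [this]
  fun_prop

@[fun_prop]
theorem add {M N : α → ℕ} (hM : PTime M) (hN : PTime N) : PTime (fun x => M x + N x) := by
  have : (fun x => M x + N x) = fun x => (List.range (M x) ++ List.range (N x)).length := by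
    funext x
    simp
  rw [this]
  fun_prop

@[fun_prop]
theorem mul {M N : α → ℕ} (hM : PTime M) (hN : PTime N) : PTime (fun x => M x * N x) := by
  have : (fun x => M x * N x) =
      fun x => ((List.range (M x)).flatMap fun _ => List.range (N x)).length := by
    funext x
    simp [List.length_flatMap]
  rw [this]
  fun_prop

end PTime

end FillIn

/-! ### The algorithm, and polynomial time for its subroutines -/

namespace FillIn

open Enc

/-! ### The algorithm

Vertices are numbers below `n`, sets of vertices are bit vectors and graphs are bit matrices. -/

namespace Alg

variable {α : Type*} [Enc α]

/-- Membership in a set of vertices. -/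
def mem (S : List Bool) (v : ℕ) : Bool := S.getD v false

/-- Adjacency. -/
def adj (M : List (List Bool)) (i j : ℕ) : Bool := (M.getD i []).getD j false

/-- The bit vector of a predicate. -/
def tab (n : ℕ) (p : ℕ → Bool) : List Bool := (List.range n).map p

/-- The bit matrix of a relation. -/
def tab₂ (n : ℕ) (p : ℕ → ℕ → Bool) : List (List Bool) :=
  (List.range n).map fun i => (List.range n).map (p i)

/-- Adds to `S` its neighbours in `U`. -/
def growStep (n : ℕ) (M : List (List Bool)) (U S : List Bool) : List Bool :=
  tab n fun v => mem S v || (mem U v && (List.range n).any fun u => mem S u && adj M u v)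

/-- The connected component of `c` in the subgraph induced by `U` (empty if `c` is not in `U`). -/
def component (n : ℕ) (M : List (List Bool)) (U : List Bool) (c : ℕ) : List Bool :=
  (List.range n).foldl (fun S _ => growStep n M U S) (tab n fun v => v == c && mem U v)

/-- The neighbours outside `U` of the component of `c` in `U`. -/
def attach (n : ℕ) (M : List (List Bool)) (U : List Bool) (c : ℕ) : List Bool :=
  tab n fun v => !mem U v && (List.range n).any fun u => mem (component n M U c) u && adj M u v

/-- One step of the triangulation: for each component of the graph outside the closed neighbourhood
of `w`, its neighbourhood is completed. -/
def fillStep (n : ℕ) (M : List (List Bool)) (w : ℕ) : List (List Bool) :=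
  tab₂ n fun i j => adj M i j || (!(i == j) && (List.range n).any fun c =>
    mem (attach n M (tab n fun v => !(v == w) && !adj M w v) c) i &&
    mem (attach n M (tab n fun v => !(v == w) && !adj M w v) c) j)

/-- A triangulation. -/
def fill (n : ℕ) (M : List (List Bool)) : List (List Bool) :=
  (List.range n).foldl (fillStep n) M

/-- Removes all edges at vertices of `Z`. -/
def isolate (n : ℕ) (M : List (List Bool)) (Z : List Bool) : List (List Bool) :=
  tab₂ n fun i j => adj M i j && (!mem Z i && !mem Z j)

/-- Membership in a closed neighbourhood. -/
def adjEq (M : List (List Bool)) (i j : ℕ) : Bool := i == j || adj M i j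

/-- The common closed neighbours of `x` and `y` whose closed neighbourhood contains all common
neighbours of `u` and `v`. -/
def pick (n : ℕ) (H : List (List Bool)) (u v x y : ℕ) : List Bool :=
  tab n fun w => adjEq H x w && (adjEq H y w && (List.range n).all fun s =>
    !(adj H u s && adj H v s) || adjEq H w s)

/-- The candidates obtained from the set `Z`. -/
def candidates (n : ℕ) (M : List (List Bool)) (Z : List Bool) : List (List Bool) :=
  Z :: (List.range n).flatMap fun u => (List.range n).flatMap fun v =>
    (List.range n).flatMap fun x => (List.range n).flatMap fun y =>
      (List.range n).map fun z =>
        tab n fun w => mem Z w || (w == z || mem (pick n (fill n (isolate n M Z)) u v x y) w)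

/-- The test for potential maximal cliques. -/
def isPMC (n : ℕ) (M : List (List Bool)) (Ω : List Bool) : Bool :=
  ((List.range n).all fun c => mem Ω c || (List.range n).any fun w =>
    mem Ω w && !mem (attach n M (tab n fun v => !mem Ω v) c) w) &&
  -- Here `c` need not be tested for lying outside `Ω`: for `c` in `Ω` the component is empty and
  -- attached to nothing.
  ((List.range n).all fun u => (List.range n).all fun v =>
    !(mem Ω u && mem Ω v) || (adjEq M u v || (List.range n).any fun c =>
      mem (attach n M (tab n fun v => !mem Ω v) c) u &&
      mem (attach n M (tab n fun v => !mem Ω v) c) v))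

/-- Is `Ω \ Z` a clique? -/
def isCliqueOff (n : ℕ) (M : List (List Bool)) (Ω Z : List Bool) : Bool :=
  (List.range n).all fun i => (List.range n).all fun j =>
    !((mem Ω i && !mem Z i) && (mem Ω j && !mem Z j)) || adjEq M i j

/-- Equality of bit vectors. -/
def same (n : ℕ) (S T : List Bool) : Bool := (List.range n).all fun v => mem S v == mem T v

/-- Removal of duplicates. -/
def dedup (n : ℕ) (L : List (List Bool)) : List (List Bool) :=
  L.foldl (fun acc S => bif acc.any (same n S) then acc else S :: acc) []

/-- The quasi-cliques, given a list of all small sets. -/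
def enumerate (M : List (List Bool)) (L : List (List Bool)) : List (List Bool) :=
  dedup M.length ((L.flatMap (candidates M.length M)).filter fun Ω =>
    isPMC M.length M Ω && L.any (isCliqueOff M.length M Ω))

/-- Adds to the list `L` all sets obtained by adding one vertex to a member. -/
def smallStep (n : ℕ) (L : List (List Bool)) : List (List Bool) :=
  L ++ L.flatMap fun S => (List.range n).map fun v => tab n fun w => mem S w || w == v

/-- The sets of at most `m` vertices. -/
def smallSets (n m : ℕ) : List (List Bool) :=
  (List.range m).foldl (fun L _ => smallStep n L) [tab n fun _ => false]

/-- The value of a binary number, least significant bit first. -/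
def value (l : List Bool) : ℕ :=
  l.reverse.foldl (fun a b => (a + a) + bif b then 1 else 0) 0

/-- The integer part of `5 √k`. -/
def sizeBound (k : ℕ) : ℕ :=
  -- This counts the positive integers `j + 1` whose square is at most `25 k = (5 √k) ^ 2`.
  ((List.range (25 * k)).filter fun j => Nat.ble ((j + 1) * (j + 1)) (25 * k)).length

/-- The list of quasi-cliques of an instance. -/
def quasiCliques (x : List (List Bool) × List Bool) : List (List Bool) :=
  enumerate x.1 (smallSets x.1.length (sizeBound (value x.2)))

@[fun_prop]
theorem ptime_mem {S : α → List Bool} {v : α → ℕ} (hS : PTime S) (hv : PTime v) :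
    PTime fun x => mem (S x) (v x) := by
  unfold mem; fun_prop

@[fun_prop]
theorem ptime_adj {M : α → List (List Bool)} {i j : α → ℕ} (hM : PTime M) (hi : PTime i)
    (hj : PTime j) : PTime fun x => adj (M x) (i x) (j x) := by
  unfold adj; fun_prop

@[fun_prop]
theorem ptime_adjEq {M : α → List (List Bool)} {i j : α → ℕ} (hM : PTime M) (hi : PTime i)
    (hj : PTime j) : PTime fun x => adjEq (M x) (i x) (j x) := by
  unfold adjEq; fun_prop

@[fun_prop]
theorem ptime_tab {n : α → ℕ} {p : α → ℕ → Bool} (hn : PTime n)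
    (hp : PTime fun q : α × ℕ => p q.1 q.2) : PTime fun x => tab (n x) (p x) := by
  unfold tab; fun_prop

@[fun_prop]
theorem ptime_tab₂ {n : α → ℕ} {p : α → ℕ → ℕ → Bool} (hn : PTime n)
    (hp : PTime fun q : (α × ℕ) × ℕ => p q.1.1 q.1.2 q.2) : PTime fun x => tab₂ (n x) (p x) := by
  unfold tab₂
  exact PTime.map (by fun_prop) (PTime.map (f := fun (q : α × ℕ) j => p q.1 q.2 j)
    (by fun_prop) hp)

@[fun_prop]
theorem ptime_growStep {n : α → ℕ} {M : α → List (List Bool)} {U S : α → List Bool} (hn : PTime n)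
    (hM : PTime M) (hU : PTime U) (hS : PTime S) :
    PTime fun x => growStep (n x) (M x) (U x) (S x) := by
  unfold growStep; fun_prop

theorem wd_tab_le (n : ℕ) (p : ℕ → Bool) : wd (tab n p) ≤ n + 1 := by
  rw [wd_list_le]
  exact ⟨by simp [tab], fun a _ => (wd_bool a).trans (by omega)⟩

theorem wd_tab₂_le (n : ℕ) (p : ℕ → ℕ → Bool) : wd (tab₂ n p) ≤ n + 1 := by
  rw [wd_list_le]
  refine ⟨by simp [tab₂], fun a ha => ?_⟩
  obtain ⟨i, -, rfl⟩ := List.mem_map.1 ha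
  exact wd_tab_le n _

theorem polyBdd_succ {n : α → ℕ} (hn : PTime n) : PolyBdd wd fun x => n x + 1 := by
  simpa only [wd_nat] using hn.wd_bdd.add (PolyBdd.const 1)

@[fun_prop]
theorem ptime_component {n : α → ℕ} {M : α → List (List Bool)} {U : α → List Bool} {c : α → ℕ}
    (hn : PTime n) (hM : PTime M) (hU : PTime U) (hc : PTime c) :
    PTime fun x => component (n x) (M x) (U x) (c x) := by
  unfold component
  exact PTime.foldl_of_wd_le (f := fun x (S : List Bool) (_ : ℕ) => growStep (n x) (M x) (U x) S)
    (by fun_prop) (by fun_prop) (by fun_prop) _ (polyBdd_succ hn) fun x _ _ => wd_tab_le _ _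

@[fun_prop]
theorem ptime_attach {n : α → ℕ} {M : α → List (List Bool)} {U : α → List Bool} {c : α → ℕ}
    (hn : PTime n) (hM : PTime M) (hU : PTime U) (hc : PTime c) :
    PTime fun x => attach (n x) (M x) (U x) (c x) := by
  unfold attach; fun_prop

@[fun_prop]
theorem ptime_fillStep {n : α → ℕ} {M : α → List (List Bool)} {w : α → ℕ}
    (hn : PTime n) (hM : PTime M) (hw : PTime w) :
    PTime fun x => fillStep (n x) (M x) (w x) := by
  unfold fillStep; fun_prop

@[fun_prop]
theorem ptime_fill {n : α → ℕ} {M : α → List (List Bool)} (hn : PTime n) (hM : PTime M) :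
    PTime fun x => fill (n x) (M x) := by
  unfold fill
  exact PTime.foldl_of_wd_le (f := fun x (M : List (List Bool)) (w : ℕ) => fillStep (n x) M w)
    (by fun_prop) (by fun_prop) (by fun_prop) _ (polyBdd_succ hn) fun x _ _ => wd_tab₂_le _ _

@[fun_prop]
theorem ptime_isolate {n : α → ℕ} {M : α → List (List Bool)} {Z : α → List Bool}
    (hn : PTime n) (hM : PTime M) (hZ : PTime Z) :
    PTime fun x => isolate (n x) (M x) (Z x) := by
  unfold isolate; fun_prop

@[fun_prop]
theorem ptime_pick {n : α → ℕ} {H : α → List (List Bool)} {u v w y : α → ℕ} (hn : PTime n)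
    (hH : PTime H) (hu : PTime u) (hv : PTime v) (hw : PTime w) (hy : PTime y) :
    PTime fun x => pick (n x) (H x) (u x) (v x) (w x) (y x) := by
  unfold pick; fun_prop

@[fun_prop]
theorem ptime_candidates {n : α → ℕ} {M : α → List (List Bool)} {Z : α → List Bool}
    (hn : PTime n) (hM : PTime M) (hZ : PTime Z) :
    PTime fun x => candidates (n x) (M x) (Z x) := by
  unfold candidates; fun_prop

@[fun_prop]
theorem ptime_isPMC {n : α → ℕ} {M : α → List (List Bool)} {Z : α → List Bool}
    (hn : PTime n) (hM : PTime M) (hZ : PTime Z) :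
    PTime fun x => isPMC (n x) (M x) (Z x) := by
  unfold isPMC; fun_prop

@[fun_prop]
theorem ptime_isCliqueOff {n : α → ℕ} {M : α → List (List Bool)} {Ω Z : α → List Bool}
    (hn : PTime n) (hM : PTime M) (hΩ : PTime Ω) (hZ : PTime Z) :
    PTime fun x => isCliqueOff (n x) (M x) (Ω x) (Z x) := by
  unfold isCliqueOff; fun_prop

@[fun_prop]
theorem ptime_same {n : α → ℕ} {S T : α → List Bool} (hn : PTime n) (hS : PTime S)
    (hT : PTime T) : PTime fun x => same (n x) (S x) (T x) := by
  unfold same; fun_prop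

theorem dedup_concat (n : ℕ) (L : List (List Bool)) (S : List Bool) : dedup n (L ++ [S]) =
    bif (dedup n L).any (same n S) then dedup n L else S :: dedup n L := by
  simp [dedup]

theorem subset_and_length_dedup_le (n : ℕ) (L : List (List Bool)) :
    dedup n L ⊆ L ∧ (dedup n L).length ≤ L.length := by
  induction L using List.reverseRecOn with
  | nil => exact ⟨List.Subset.refl _, le_rfl⟩
  | append_singleton l c ih =>
    rw [dedup_concat]
    cases (dedup n l).any (same n c)
    · refine ⟨?_, by simpa using ih.2⟩
      intro x hx
      rcases List.mem_cons.1 hx with rfl | h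
      · simp
      · exact List.mem_append_left _ (ih.1 h)
    · exact ⟨fun x hx => List.mem_append_left _ (ih.1 hx), ih.2.trans (by simp)⟩

@[fun_prop]
theorem ptime_dedup {n : α → ℕ} {L : α → List (List Bool)} (hn : PTime n) (hL : PTime L) :
    PTime fun x => dedup (n x) (L x) := by
  unfold dedup
  refine PTime.foldl (f := fun x (acc : List (List Bool)) (S : List Bool) =>
    bif acc.any (same (n x) S) then acc else S :: acc)
    (by fun_prop) (by fun_prop) (by fun_prop) _ hL.wd_bdd fun x l hl => ?_
  obtain ⟨h₁, h₂⟩ := subset_and_length_dedup_le (n x) l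
  exact wd_list_le.2 ⟨h₂.trans (hl.length_le.trans (length_le_wd _)),
    fun a ha => wd_le_of_mem (hl.subset (h₁ ha))⟩

theorem ptime_enumerate : PTime fun x : List (List Bool) × List (List Bool) =>
    enumerate x.1 x.2 := by
  unfold enumerate; fun_prop

@[fun_prop]
theorem ptime_smallStep {n : α → ℕ} {L : α → List (List Bool)} (hn : PTime n) (hL : PTime L) :
    PTime fun x => smallStep (n x) (L x) := by
  unfold smallStep; fun_prop

@[fun_prop]
theorem ptime_sizeBound {k : α → ℕ} (hk : PTime k) : PTime fun x => sizeBound (k x) := by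
  unfold sizeBound; fun_prop

end Alg

end FillIn

/-! ### The bound `n ^ O(√k)` -/

namespace FillIn

open Enc

namespace Alg

/-! ### Running time -/

theorem value_cons (b : Bool) (l : List Bool) :
    value (b :: l) = (value l + value l) + bif b then 1 else 0 := by
  simp [value]

theorem value_bits (k : ℕ) : value k.bits = k := by
  induction k using Nat.binaryRec' with
  | zero => rfl
  | bit b n h ih =>
    rw [Nat.bits_append_bit n b h, value_cons, ih, Nat.bit_val]
    cases b <;> simp <;> omega

/-- The Horner scheme in `value` runs through the values of the suffixes, so this bounds its
accumulators. -/
theorem value_le_of_suffix {l l' : List Bool} (h : l <:+ l') : value l ≤ value l' := by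
  obtain ⟨t, rfl⟩ := h
  induction t with
  | nil => rfl
  | cons b t ih =>
    rw [List.cons_append, value_cons]
    omega

theorem sizeBound_eq (k : ℕ) : sizeBound k = Nat.sqrt (25 * k) := by
  have h : ∀ N, ((List.range N).filter fun j => Nat.ble ((j + 1) * (j + 1)) (25 * k)).length =
      min N (Nat.sqrt (25 * k)) := by
    intro N
    induction N with
    | zero => simp
    | succ N ih =>
      rw [List.range_succ, List.filter_append, List.length_append, ih]
      by_cases hN : (N + 1) * (N + 1) ≤ 25 * k
      · have := Nat.le_sqrt.2 hN
        simp [hN]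
        omega
      · have := mt Nat.le_sqrt.1 hN
        simp [hN]
        omega
  rw [sizeBound, h, min_eq_right (Nat.sqrt_le_self _)]

theorem smallSets_succ (n m : ℕ) : smallSets n (m + 1) = smallStep n (smallSets n m) := by
  simp [smallSets, List.range_succ]

/-- Each step keeps every member and adds its `n` extensions, repetitions included, so the length is
exactly `(n + 1) ^ m`. -/
theorem wd_smallSets_le (n m : ℕ) : wd (smallSets n m) ≤ (n + 1) ^ m + n := by
  have key : (smallSets n m).length = (n + 1) ^ m ∧ ∀ S ∈ smallSets n m, wd S ≤ n + 1 := by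
    induction m with
    | zero =>
      refine ⟨rfl, fun S hS => ?_⟩
      obtain rfl : S = _ := by simpa [smallSets] using hS
      exact wd_tab_le _ _
    | succ m ih =>
      rw [smallSets_succ]
      refine ⟨?_, fun S hS => ?_⟩
      · simp [smallStep, List.length_flatMap, ih.1, pow_succ]
        ring
      · rcases List.mem_append.1 hS with hS | hS
        · exact ih.2 S hS
        · simp only [List.mem_flatMap, List.mem_map] at hS
          obtain ⟨_, _, _, _, rfl⟩ := hS
          exact wd_tab_le _ _
  have : 1 ≤ (n + 1) ^ m := Nat.one_le_pow _ _ (by omega)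
  exact wd_list_le.2 ⟨by omega, fun S hS => (key.2 S hS).trans (by omega)⟩

/-- The measure of the running time. -/
def cost (x : List (List Bool) × List Bool) : ℕ :=
  -- The number `k` arrives in binary but is handled in unary, so its value enters the measure.
  wd x + value x.2 + (x.1.length + 1) ^ sizeBound (value x.2)

/-- Decoding `k` and listing the small sets are the only steps that can leave polynomial size; their
accumulators stay below `cost`. The rest is polynomial time in their results. -/
theorem timed_quasiCliques : Timed cost quasiCliques := by
  have hμ : PolyBdd cost wd := (PolyBdd.self cost).mono fun x => by simp only [cost]; omega
  have hv : Timed cost fun x : List (List Bool) × List Bool => value x.2 := by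
    unfold value
    refine Timed.foldl hμ (PTime.timed (by fun_prop) hμ) (PTime.timed (by fun_prop) hμ)
      (f := fun _ (a : ℕ) (b : Bool) => (a + a) + bif b then 1 else 0) (by fun_prop)
      cost (PolyBdd.self _) fun x l hl => ?_
    rw [wd_nat]
    have : List.foldl (fun (a : ℕ) (b : Bool) => (a + a) + bif b then 1 else 0) 0 l =
        value l.reverse := by simp [value]
    rw [this]
    have hs : l.reverse <:+ x.2 := by
      rw [← List.reverse_reverse x.2]
      exact List.reverse_suffix.2 hl
    have := value_le_of_suffix hs
    simp only [cost]
    omega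
  have hm : Timed cost fun x : List (List Bool) × List Bool => sizeBound (value x.2) :=
    Timed.comp' (G := sizeBound) (by fun_prop) hv hμ
  have hs : Timed cost fun x : List (List Bool) × List Bool =>
      smallSets x.1.length (sizeBound (value x.2)) := by
    unfold smallSets
    refine Timed.foldl hμ (Timed.comp' (G := List.range) (by fun_prop) hm hμ)
      (PTime.timed (by fun_prop) hμ)
      (f := fun (x : List (List Bool) × List Bool) (L : List (List Bool)) (_ : ℕ) =>
        smallStep x.1.length L) (by fun_prop) cost (PolyBdd.self _) fun x l hl => ?_
    have hlen := hl.length_le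
    have h₁ : l.foldl (fun L _ => smallStep x.1.length L) [tab x.1.length fun _ => false] =
        smallSets x.1.length l.length := by
      clear hl hlen
      induction l using List.reverseRecOn with
      | nil => rfl
      | append_singleton l c ih =>
        rw [List.foldl_append, ih, List.length_append, List.length_singleton, smallSets_succ]
        rfl
    rw [h₁]
    refine (wd_smallSets_le _ _).trans ?_
    have h₂ : x.1.length ≤ wd x := (length_le_wd _).trans (wd_fst_le x)
    have h₃ : (x.1.length + 1) ^ l.length ≤ (x.1.length + 1) ^ sizeBound (value x.2) :=
      Nat.pow_le_pow_right (by omega) (by simpa using hlen)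
    simp only [cost]
    omega
  exact Timed.comp' (F := fun x : List (List Bool) × List Bool =>
    (x.1, smallSets x.1.length (sizeBound (value x.2)))) ptime_enumerate
    (Timed.prodMk (PTime.timed (by fun_prop) hμ) hs) hμ

theorem sizeBound_le (k : ℕ) : (sizeBound k : ℝ) ≤ 5 * √(k : ℝ) := by
  rw [sizeBound_eq]
  refine (Real.nat_sqrt_le_real_sqrt).trans_eq ?_
  push_cast
  rw [Real.sqrt_mul (by norm_num), show (25 : ℝ) = 5 ^ 2 by norm_num, Real.sqrt_sq (by norm_num)]

/-- The exponent of the running time. -/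
theorem cost_le {n k : ℕ} {x : List (List Bool) × List Bool} (hn : x.1.length = n)
    (hk : value x.2 = k) (hw : wd x ≤ n + k + 3) :
    ((cost x + 2 : ℕ) : ℝ) ≤ ((max n 2 : ℕ) : ℝ) ^ ((16 : ℝ) * √((max k 1 : ℕ) : ℝ)) := by
  set N : ℝ := ((max n 2 : ℕ) : ℝ) with hN
  set s : ℝ := √((max k 1 : ℕ) : ℝ) with hs
  have hN2 : (2 : ℝ) ≤ N := by rw [hN]; exact_mod_cast le_max_right _ _
  have hnN : (n : ℝ) ≤ N := by rw [hN]; exact_mod_cast le_max_left _ _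
  have hs1 : 1 ≤ s := by
    rw [hs, Real.one_le_sqrt]
    exact_mod_cast le_max_right _ _
  have hks : √(k : ℝ) ≤ s := Real.sqrt_le_sqrt (by exact_mod_cast le_max_left _ _)
  have hNs : N ≤ N ^ s := by
    simpa using Real.rpow_le_rpow_of_exponent_le (show 1 ≤ N by linarith) hs1
  have hNs2 : (2 : ℝ) ≤ N ^ s := hN2.trans hNs
  -- Bernoulli's inequality: `1 + s ≤ 2 ^ s`.
  have hsN : s ≤ N ^ s := by
    have h₁ : 1 + s * 1 ≤ (1 + 1) ^ s := one_add_mul_self_le_rpow_one_add (by norm_num) hs1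
    have h₂ : (1 + 1 : ℝ) ^ s ≤ N ^ s := Real.rpow_le_rpow (by norm_num) (by linarith) (by linarith)
    linarith
  set E := N ^ s with hE
  have hkE : (k : ℝ) ≤ E ^ 2 := by
    calc (k : ℝ) = √(k : ℝ) ^ 2 := (Real.sq_sqrt (by positivity)).symm
      _ ≤ E ^ 2 := by gcongr; exact hks.trans hsN
  -- Here `n + 1 ≤ N ^ 2` and the exponent is at most `5 √k ≤ 5 s`, which gives `N ^ (10 s)`.
  have hpow : ((n : ℝ) + 1) ^ sizeBound k ≤ E ^ 10 := by
    calc ((n : ℝ) + 1) ^ sizeBound k ≤ (N ^ 2) ^ sizeBound k := by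
          gcongr
          nlinarith
      _ = N ^ (2 * (sizeBound k : ℝ)) := by
          rw [← pow_mul, ← Real.rpow_natCast]
          push_cast
          rfl
      _ ≤ N ^ (s * 10) := by
          apply Real.rpow_le_rpow_of_exponent_le (by linarith)
          have := sizeBound_le k
          linarith
      _ = E ^ 10 := by
          rw [hE, Real.rpow_mul (by linarith)]
          exact_mod_cast rfl
  have hcost : ((cost x + 2 : ℕ) : ℝ) ≤ E + 2 * E ^ 2 + 5 + E ^ 10 := by
    have h₁ : ((cost x + 2 : ℕ) : ℝ) ≤ n + 2 * k + 5 + ((n : ℝ) + 1) ^ sizeBound k := by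
      have : cost x + 2 ≤ n + 2 * k + 5 + (n + 1) ^ sizeBound k := by
        simp only [cost, hn, hk]
        omega
      exact_mod_cast this
    linarith
  have h1E : 1 ≤ E := by linarith
  have h₁ : E ≤ E ^ 10 := by simpa using pow_le_pow_right₀ h1E (show 1 ≤ 10 by norm_num)
  have h₂ : E ^ 2 ≤ E ^ 10 := pow_le_pow_right₀ h1E (by norm_num)
  have h₃ : (5 : ℝ) ≤ 5 * E ^ 10 := by nlinarith
  -- All terms together are at most `9 * E ^ 10`; the constant is rounded up to `2 ^ 4`, which `E ^
  -- 4` absorbs because `E ≥ 2`.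
  calc ((cost x + 2 : ℕ) : ℝ) ≤ 16 * E ^ 10 := by nlinarith
    _ ≤ E ^ 4 * E ^ 10 := by
        gcongr
        calc (16 : ℝ) = 2 ^ 4 := by norm_num
          _ ≤ E ^ 4 := by gcongr
    _ ≤ E ^ 16 := by
        rw [← pow_add]
        exact pow_le_pow_right₀ h1E (by norm_num)
    _ = N ^ (16 * s) := by
        rw [hE, mul_comm, Real.rpow_mul (by linarith)]
        exact_mod_cast rfl

end Alg

end FillIn

/-! ### Components and chordal graphs -/

namespace FillIn

section Connectivity

variable {V : Type*} {A B : SimpleGraph V} {U U' : Set V} {a b c u v : V}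

/-! ### Components of induced subgraphs -/

/-- `v` is in the component of `c` in the subgraph of `A` induced by `U`. -/
def Conn (A : SimpleGraph V) (U : Set V) (c v : V) : Prop :=
  c ∈ U ∧ Relation.ReflTransGen (fun a b => A.Adj a b ∧ b ∈ U) c v

/-- `v` is a neighbour outside `U` of the component of `c` in `U`. -/
def Att (A : SimpleGraph V) (U : Set V) (c v : V) : Prop :=
  v ∉ U ∧ ∃ u, Conn A U c u ∧ A.Adj u v

namespace Conn

theorem refl (h : c ∈ U) : Conn A U c c := ⟨h, .refl⟩

theorem tail (h : Conn A U a b) (hbc : A.Adj b c) (hc : c ∈ U) : Conn A U a c :=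
  ⟨h.1, h.2.tail ⟨hbc, hc⟩⟩

theorem trans (h : Conn A U a b) (h' : Conn A U b c) : Conn A U a c := ⟨h.1, h.2.trans h'.2⟩

theorem induction {P : V → Prop} (h : Conn A U a b) (ha : P a)
    (hP : ∀ x y, Conn A U a x → P x → A.Adj x y → y ∈ U → P y) : P b := by
  obtain ⟨h₀, h⟩ := h
  induction h with
  | refl => exact ha
  | tail h₁ h₂ ih => exact hP _ _ ⟨h₀, h₁⟩ ih h₂.1 h₂.2

theorem mem_right (h : Conn A U a b) : b ∈ U := h.induction h.1 fun _ _ _ _ _ h => h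

theorem symm (h : Conn A U a b) : Conn A U b a :=
  h.induction (P := fun z => Conn A U z a) (refl h.1) fun _ _ hx ih hxy hy =>
    ((refl hy).tail hxy.symm hx.mem_right).trans ih

theorem of_forall (h : Conn A U a b) (hAB : ∀ x y, Conn A U a x → Conn A U a y → A.Adj x y →
    B.Adj x y) (hU : ∀ x, Conn A U a x → x ∈ U') : Conn B U' a b :=
  h.induction (refl (hU _ (refl h.1))) fun _ _ hx ih hxy hy =>
    ih.tail (hAB _ _ hx (hx.tail hxy hy) hxy) (hU _ (hx.tail hxy hy))

theorem mono (h : Conn A U a b) (hAB : A ≤ B) (hU : U ⊆ U') : Conn B U' a b :=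
  h.of_forall (fun _ _ _ _ h => hAB h) fun _ hx => hU hx.mem_right

/-- A connection that leaves `P` does so for the first time somewhere. -/
theorem exit {P : Set V} (h : Conn A U a b) (ha : a ∈ P) (hb : b ∉ P) :
    ∃ x y, Conn A (U ∩ P) a x ∧ A.Adj x y ∧ y ∈ U ∧ y ∉ P := by
  by_contra! hcon
  exact hb (h.induction (P := fun z => Conn A (U ∩ P) a z) (refl ⟨h.1, ha⟩)
    fun x y _ hx hxy hy => hx.tail hxy ⟨hy, hcon x y hx hxy hy⟩).mem_right.2

end Conn

theorem Att.mono (h : Att A U c v) (hAB : A ≤ B) (hU : U ⊆ U') (hv : v ∉ U') : Att B U' c v :=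
  ⟨hv, h.2.imp fun _ h => ⟨h.1.mono hAB hU, hAB h.2⟩⟩

theorem Att.mem (h : Att A U c v) : c ∈ U := h.2.choose_spec.1.1

theorem Att.of_conn (h : Att A U c v) (hb : Conn A U b c) : Att A U b v :=
  ⟨h.1, h.2.imp fun _ h => ⟨hb.trans h.1, h.2⟩⟩

/-- If two nonadjacent vertices are connected through `U`, both are attached to one component. -/
theorem Conn.exists_att (h : Conn A (U ∪ {u, v}) u v) (huv : u ≠ v) (hadj : ¬ A.Adj u v)
    (hu : u ∉ U) (hv : v ∉ U) : ∃ x, Att A U x u ∧ Att A U x v := by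
  -- Follow the connection from `v` until it first meets `u`, then back from there until it first
  -- meets `v`; the stretch in between lies in `U`.
  obtain ⟨x, y, hx, hxy, hy, hyP⟩ := h.symm.exit (P := {u}ᶜ) huv.symm (by simp)
  obtain rfl : y = u := by simpa using hyP
  have hxv : x ≠ v := by rintro rfl; exact hadj hxy.symm
  obtain ⟨x', y', hx', hxy', hy', hyP'⟩ := hx.symm.exit (P := {v}ᶜ) hxv (by simp)
  obtain rfl : y' = v := by simpa using hyP'
  have hsub : (U ∪ {y, y'}) ∩ {y}ᶜ ∩ {y'}ᶜ ⊆ U := by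
    rintro z ⟨⟨hz | hz | hz, h₁⟩, h₂⟩
    · exact hz
    · exact absurd hz h₁
    · exact absurd hz h₂
  have h₁ := hx'.mono le_rfl hsub
  exact ⟨x, ⟨hu, x, Conn.refl h₁.1, hxy⟩, hv, x', h₁, hxy'⟩

/-- No edge leads from `D` to the complement of `D ∪ K`. -/
def Sep (A : SimpleGraph V) (D K : Set V) : Prop := ∀ x ∈ D, ∀ y, A.Adj x y → y ∈ D ∨ y ∈ K

theorem sep_component (A : SimpleGraph V) (U : Set V) (c : V) :
    Sep A {v | Conn A U c v} {v | Att A U c v} := by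
  intro x hx y hxy
  by_cases hy : y ∈ U
  · exact .inl (hx.tail hxy hy)
  · exact .inr ⟨hy, x, hx, hxy⟩

theorem Sep.conn {D K : Set V} (h : Sep A D K) (hc : c ∈ D) (hcv : Conn A U c v)
    (hU : ∀ x ∈ U, x ∉ K) : v ∈ D :=
  hcv.induction hc fun x y _ hx hxy hy => (h x hx y hxy).resolve_right (hU y hy)

end Connectivity

/-! ### Chordal graphs -/

section Chordal

variable {V : Type*} {G H : SimpleGraph V} {U : Set V} {c d u v w : V}

/-- The vertices outside the closed neighbourhood of `v`. -/
def far (H : SimpleGraph V) (v : V) : Set V := {w | w ≠ v ∧ ¬ H.Adj v w}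

/-- The neighbourhood of every component outside the closed neighbourhood of `v` is a clique. -/
def SimplicialAt (H : SimpleGraph V) (v : V) : Prop :=
  ∀ c p q, Att H (far H v) c p → Att H (far H v) c q → p ≠ q → H.Adj p q

theorem adj_of_att_far (h : Att H (far H v) c w) : H.Adj v w := by
  obtain ⟨hw, u, hu, huw⟩ := h
  by_contra hvw
  refine hw ⟨?_, hvw⟩
  rintro rfl
  exact hu.mem_right.2 huw.symm

theorem cycleGraph_adj_iff {m : ℕ} (hm : 3 ≤ m) (i j : Fin m) : (SimpleGraph.cycleGraph m).Adj i j ↔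
    i.val + 1 = j.val ∨ j.val + 1 = i.val ∨ (i.val = 0 ∧ j.val + 1 = m) ∨
      (j.val = 0 ∧ i.val + 1 = m) := by
  have hsub : ∀ i j : Fin m, (i - j).val = if j.val ≤ i.val then i.val - j.val
      else m + i.val - j.val := by
    intro i j
    split_ifs with h
    · exact Fin.coe_sub_iff_le.2 h
    · exact Fin.coe_sub_iff_lt.2 (not_le.1 h)
  rw [SimpleGraph.cycleGraph_adj', hsub, hsub]
  have := i.isLt
  have := j.isLt
  split_ifs <;> omega

theorem exists_path {A : SimpleGraph V} {a b : V} (h : Conn A U a b) :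
    ∃ (m : ℕ) (f : ℕ → V), f 0 = a ∧ f m = b ∧ (∀ i < m, A.Adj (f i) (f (i + 1))) ∧
      ∀ i ≤ m, f i ∈ U := by
  refine h.induction (P := fun b => ∃ (m : ℕ) (f : ℕ → V), f 0 = a ∧ f m = b ∧
    (∀ i < m, A.Adj (f i) (f (i + 1))) ∧ ∀ i ≤ m, f i ∈ U)
    ⟨0, fun _ => a, rfl, rfl, by simp, fun _ _ => h.1⟩ ?_
  rintro x y _ ⟨m, f, h₀, h₁, h₂, h₃⟩ hxy hy
  refine ⟨m + 1, fun i => if i ≤ m then f i else y, by simpa using h₀, by simp, fun i hi => ?_,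
    fun i hi => ?_⟩
  · rcases Nat.lt_succ_iff_lt_or_eq.1 hi with hi | rfl
    · simpa [hi.le, hi] using h₂ i hi
    · simpa [h₁] using hxy
  · dsimp only
    split_ifs with h
    · exact h₃ i h
    · exact hy

/-- Connected vertices are connected by an induced path. -/
theorem exists_induced_path {A : SimpleGraph V} {a b : V} (h : Conn A U a b) (hab : a ≠ b) :
    ∃ (m : ℕ) (f : ℕ → V), f 0 = a ∧ f m = b ∧ (∀ i ≤ m, f i ∈ U) ∧
      (∀ i j, i < j → j ≤ m → f i ≠ f j) ∧
      ∀ i j, i < j → j ≤ m → (A.Adj (f i) (f j) ↔ j = i + 1) := by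
  classical
  have hex := exists_path h
  set m := Nat.find hex with hm
  obtain ⟨f, h₀, h₁, h₂, h₃⟩ := Nat.find_spec hex
  rw [← hm] at h₁ h₂ h₃
  have key : ∀ i j, i < j → j ≤ m → A.Adj (f i) (f j) → j = i + 1 := by
    intro i j hij hj hadj
    by_contra hne
    -- A chord from `f i` to `f j` bypasses `j - i - 1` vertices and contradicts the minimal length.
    refine Nat.find_min hex (m := m - (j - i - 1)) (by omega)
      ⟨fun k => if k ≤ i then f k else f (k + (j - i - 1)), by simpa using h₀, ?_, fun k hk => ?_,
        fun k hk => ?_⟩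
    · have : ¬ m - (j - i - 1) ≤ i := by omega
      simp only [this, if_false]
      rw [← h₁]
      congr 1
      omega
    · rcases lt_trichotomy k i with hki | rfl | hki
      · have : k + 1 ≤ i := hki
        simpa [hki.le, this] using h₂ k (by omega)
      · have : k + 1 + (j - k - 1) = j := by omega
        simpa [this] using hadj
      · have h₄ : ¬ k ≤ i := by omega
        have h₅ : ¬ k + 1 ≤ i := by omega
        have h₆ : k + 1 + (j - i - 1) = k + (j - i - 1) + 1 := by omega
        simp only [h₄, h₅, if_false, h₆]
        exact h₂ _ (by omega)
    · dsimp only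
      split_ifs
      · exact h₃ _ (by omega)
      · exact h₃ _ (by omega)
  refine ⟨m, f, h₀, h₁, h₃, fun i j hij hj heq => ?_, fun i j hij hj => ⟨key i j hij hj, ?_⟩⟩
  -- If `f i = f j`, the successor of `f j` would be a chord end for `f i`; if `j` is the last
  -- index, the predecessor of `f i` plays this role.
  · rcases hj.lt_or_eq with hj | rfl
    · have := h₂ j hj
      rw [← heq] at this
      have := key i (j + 1) (by omega) (by omega) this
      omega
    · rcases Nat.eq_zero_or_pos i with rfl | hi
      · exact hab (by rw [← h₀, ← h₁, heq])
      · have := h₂ (i - 1) (by omega)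
        rw [Nat.sub_add_cancel hi, heq] at this
        have := key (i - 1) _ (by omega) le_rfl this
        omega
  · rintro rfl
    exact h₂ i (by omega)

/-- If `p` and `q` were not adjacent, an induced path between them with its interior in `far H v`
would close up with `v` to an induced cycle of length `m + 2 ≥ 4`. -/
theorem IsChordal.simplicialAt (hH : IsChordal H) (v : V) : SimplicialAt H v := by
  intro c p q hp hq hpq
  by_contra hadj
  have hvp := adj_of_att_far hp
  have hvq := adj_of_att_far hq
  obtain ⟨x, hx, hxp⟩ := hp.2
  obtain ⟨y, hy, hyq⟩ := hq.2
  have hconn : Conn H (far H v ∪ {p, q}) p q :=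
    (((Conn.refl (by simp)).tail hxp.symm (.inl hx.mem_right)).trans
      ((hx.symm.trans hy).mono le_rfl Set.subset_union_left)).tail hyq (by simp)
  obtain ⟨m, f, h₀, h₁, hU, hinj, hf⟩ := exists_induced_path hconn hpq
  have hm : 2 ≤ m := by
    rcases m with _ | _ | m
    · exact absurd (h₀.symm.trans h₁) hpq
    · have := (hf 0 1 (by omega) (by omega)).2 rfl
      rw [h₀] at this
      exact absurd (h₁ ▸ this) hadj
    · omega
  have hfar : ∀ i, 0 < i → i < m → f i ∈ far H v := by
    intro i hi him
    rcases hU i him.le with h | h | h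
    · exact h
    · exact absurd (h₀.trans h.symm) (hinj 0 i hi him.le)
    · exact absurd (Set.mem_singleton_iff.1 h ▸ h₁.symm ▸ rfl : f i = f m) (hinj i m him le_rfl)
  have hv : ∀ i ≤ m, f i ≠ v ∧ (H.Adj v (f i) ↔ i = 0 ∨ i = m) := by
    intro i hi
    rcases Nat.eq_zero_or_pos i with rfl | hi0
    · rw [h₀]; exact ⟨hvp.ne', by simp [hvp]⟩
    · rcases hi.lt_or_eq with him | rfl
      · have := hfar i hi0 him
        exact ⟨this.1, iff_of_false this.2 (by omega)⟩
      · rw [h₁]; exact ⟨hvq.ne', by simp [hvq]⟩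
  have hm4 : 4 ≤ m + 2 := by omega
  let g : Fin (m + 2) → V := fun i => if i.val ≤ m then f i else v
  have hg : ∀ i j : Fin (m + 2), i.val < j.val → g i ≠ g j ∧
      (H.Adj (g i) (g j) ↔ (SimpleGraph.cycleGraph (m + 2)).Adj i j) := by
    intro i j hij
    have hj := j.isLt
    have hi : i.val ≤ m := by omega
    rw [cycleGraph_adj_iff (by omega)]
    by_cases hjm : j.val ≤ m
    · simp only [g, hi, hjm, if_true]
      refine ⟨hinj _ _ hij hjm, (hf _ _ hij hjm).trans ?_⟩
      omega
    · simp only [g, hi, hjm, if_true, if_false]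
      refine ⟨(hv i hi).1, (H.adj_comm _ _).trans ((hv i hi).2.trans ?_)⟩
      omega
  refine (hH (m + 2) hm4).false ⟨⟨g, fun i j hij => ?_⟩, fun {i j} => ?_⟩
  · rcases lt_trichotomy i.val j.val with h | h | h
    · exact absurd hij (hg i j h).1
    · exact Fin.ext h
    · exact absurd hij.symm (hg j i h).1
  · rcases lt_trichotomy i.val j.val with h | h | h
    · exact (hg i j h).2
    · obtain rfl := Fin.ext h
      simp
    · rw [SimpleGraph.adj_comm, SimpleGraph.adj_comm (SimpleGraph.cycleGraph _)]
      exact (hg j i h).2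

/-- On an induced cycle, the vertices other than vertex `0` and its two neighbours lie in one
component outside its closed neighbourhood. That component is attached to both neighbours, which are
not adjacent. -/
theorem isChordal_of_simplicialAt (hH : ∀ v, SimplicialAt H v) : IsChordal H := by
  refine fun m hm => ⟨fun f => ?_⟩
  have hadj : ∀ i j : Fin m, H.Adj (f i) (f j) ↔ _ :=
    fun i j => f.map_adj_iff.trans (cycleGraph_adj_iff (by omega) i j)
  have hfar : ∀ i (hi : i < m), 2 ≤ i → i ≤ m - 2 →
      f ⟨i, hi⟩ ∈ far H (f ⟨0, by omega⟩) := by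
    intro i hi h₂ h₃
    refine ⟨fun h => ?_, fun h => ?_⟩
    · have := congrArg Fin.val (f.injective h)
      simp at this
      omega
    · rw [hadj] at h
      simp at h
      omega
  have hconn : ∀ i, 2 ≤ i → (hi : i ≤ m - 2) → Conn H (far H (f ⟨0, by omega⟩))
      (f ⟨2, by omega⟩) (f ⟨i, by omega⟩) := by
    intro i h₂
    induction i, h₂ using Nat.le_induction with
    | base => exact fun _ => Conn.refl (hfar 2 (by omega) le_rfl (by omega))
    | succ i h₂ ih =>
      exact fun hi => (ih (by omega)).tail ((hadj _ _).2 (.inl rfl)) (hfar _ _ (by omega) hi)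
  have hatt : ∀ i (hi : i < m), H.Adj (f ⟨0, by omega⟩) (f ⟨i, hi⟩) →
      (i = 1 ∨ i = m - 1) → Att H (far H (f ⟨0, by omega⟩)) (f ⟨2, by omega⟩) (f ⟨i, hi⟩) := by
    rintro i hi h₀ (rfl | rfl)
    · exact ⟨fun h => h.2 h₀, _, hconn 2 le_rfl (by omega), (hadj _ _).2 (by simp)⟩
    · exact ⟨fun h => h.2 h₀, _, hconn (m - 2) (by omega) le_rfl, (hadj _ _).2 (by simp; omega)⟩
  have h₁ := hatt 1 (by omega) ((hadj _ _).2 (by simp)) (.inl rfl)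
  have h₂ := hatt (m - 1) (by omega) ((hadj _ _).2 (by simp; omega)) (.inr rfl)
  have h₃ := hH _ _ _ _ h₁ h₂ fun h => by
    have := congrArg Fin.val (f.injective h)
    simp at this
    omega
  rw [hadj] at h₃
  simp at h₃
  omega

/-- Two distinct components have adjacent common neighbours. -/
theorem IsChordal.adj_of_att (hH : IsChordal H) (hcu : Att H U c u) (hcv : Att H U c v)
    (hdu : Att H U d u) (hdv : Att H U d v) (hcd : ¬ Conn H U c d) (huv : u ≠ v) : H.Adj u v := by
  by_contra hadj
  have hvfar : v ∈ far H u := ⟨huv.symm, hadj⟩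
  -- Seen from `u`, the component of `v` outside the closed neighbourhood is attached to a vertex of
  -- each of the two components. Simpliciality at `u` joins these vertices by an edge, although the
  -- components are distinct.
  have side : ∀ e, Att H U e u → Att H U e v → ∃ y, Conn H U e y ∧ Att H (far H u) v y := by
    intro e heu hev
    obtain ⟨a, ha, hav⟩ := hev.2
    obtain ⟨a', ha', hau⟩ := heu.2
    have h₁ : Conn H ({v} ∪ {x | Conn H U e x}) v a' := by
      refine ((Conn.refl (by simp)).tail hav.symm (.inr ha)).trans
        ((ha.symm.trans ha').of_forall (fun _ _ _ _ h => h) fun x hx => .inr (ha.trans hx))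
    obtain ⟨x, y, hx, hxy, hy, hyP⟩ := h₁.exit hvfar fun h => h.2 hau.symm
    rcases hy with rfl | hy
    · exact absurd hvfar hyP
    · exact ⟨y, hy, hyP, x, hx.mono le_rfl Set.inter_subset_right, hxy⟩
  obtain ⟨y, hy, hyu⟩ := side c hcu hcv
  obtain ⟨z, hz, hzu⟩ := side d hdu hdv
  by_cases hyz : y = z
  · exact hcd (hy.trans (hyz ▸ hz.symm))
  · exact hcd ((hy.tail (hH.simplicialAt u _ _ _ hyu hzu hyz) hz.mem_right).trans hz.symm)

/-- If a component is attached to all vertices of a clique, one of its vertices is adjacent to all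
of them. -/
theorem IsChordal.exists_adj_of_isClique [Finite V] (hH : IsChordal H) {K : Set V}
    (hK : H.IsClique K) (hc : c ∈ U) (hatt : ∀ k ∈ K, Att H U c k) :
    ∃ x, Conn H U c x ∧ ∀ k ∈ K, H.Adj x k := by
  -- Take `x` with the most neighbours in `K`. If it misses `k`, walk within the component towards a
  -- neighbour of `k`: by simpliciality at `k`, the first vertex adjacent to `k` keeps all
  -- neighbours of `x` in `K` and gains `k`.
  obtain ⟨x, hx, hmax⟩ := Set.exists_max_image {x | Conn H U c x}
    (fun x => {k ∈ K | H.Adj x k}.ncard) (Set.toFinite _) ⟨c, Conn.refl hc⟩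
  refine ⟨x, hx, fun k hk => ?_⟩
  by_contra hxk
  have hkU := (hatt k hk).1
  have hxfar : x ∈ far H k :=
    ⟨fun h => hkU (h ▸ hx.mem_right), fun h => hxk h.symm⟩
  obtain ⟨a, ha, hak⟩ := (hatt k hk).2
  obtain ⟨z, y, hz, hzy, hy, hyP⟩ := (hx.symm.trans ha).exit hxfar fun h => h.2 hak.symm
  have hyatt : Att H (far H k) x y := ⟨hyP, z, hz.mono le_rfl Set.inter_subset_right, hzy⟩
  have hyk := adj_of_att_far hyatt
  have hconn : Conn H U c y := hx.trans ((hz.mono le_rfl Set.inter_subset_left).tail hzy hy)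
  refine absurd (hmax y hconn) (not_le.2 (Set.ncard_lt_ncard ?_ (Set.toFinite _)))
  refine ⟨fun l hl => ⟨hl.1, ?_⟩, fun h => hxk (h ⟨hk, hyk.symm⟩).2⟩
  have hkl : k ≠ l := by rintro rfl; exact hxk hl.2
  refine hH.simplicialAt k x y l hyatt ⟨fun h => h.2 (hK hk hl.1 hkl), x, Conn.refl hxfar, hl.2⟩ ?_
  rintro rfl
  exact (hatt _ hl.1).1 hy

end Chordal

end FillIn

/-! ### Superfluous fill edges and the theorem of Bouchitté and Todinca -/

namespace FillIn

section MinimalTriangulations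

variable {V : Type*} {G H : SimpleGraph V}

/-! ### Modifications of chordal graphs -/

/-- The graph obtained by removing the edges between `D` and `E`. -/
def cut (H : SimpleGraph V) (D E : Set V) : SimpleGraph V where
  Adj x y := H.Adj x y ∧ ¬ (x ∈ D ∧ y ∈ E) ∧ ¬ (x ∈ E ∧ y ∈ D)
  symm := ⟨fun _ _ h => ⟨h.1.symm, fun h' => h.2.2 h'.symm, fun h' => h.2.1 h'.symm⟩⟩
  loopless := ⟨fun _ h => h.1.ne rfl⟩

theorem cut_comm (H : SimpleGraph V) (D E : Set V) : cut H D E = cut H E D := by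
  ext x y
  simp only [cut]
  tauto

theorem cut_le (H : SimpleGraph V) (D E : Set V) : cut H D E ≤ H := fun _ _ h => h.1

theorem cut_adj_of_notMem {D E : Set V} {x y : V} (hx : x ∉ E) (hy : y ∉ E) :
    (cut H D E).Adj x y ↔ H.Adj x y := by
  simp only [cut]
  tauto

/-- In `cut H D E`, connections between vertices outside `E` can avoid `E`. -/
theorem conn_of_conn_cut {D E K U : Set V} {a b : V} (hK : H.IsClique K)
    (hcov : ∀ x, x ∈ D ∨ x ∈ E ∨ x ∈ K) (h : Conn (cut H D E) U a b)
    (ha : a ∉ E) (hb : b ∉ E) : Conn H (U ∩ Eᶜ) a b := by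
  -- While the walk is inside `E`, remember the vertex of `K` from which it entered. It can leave
  -- `E` only into the clique `K`, so the excursion is replaced by at most one edge.
  have key : (b ∉ E → Conn H (U ∩ Eᶜ) a b) ∧ (b ∈ E → ∃ k ∈ K, Conn H (U ∩ Eᶜ) a k) := by
    refine h.induction (P := fun b => (b ∉ E → Conn H (U ∩ Eᶜ) a b) ∧
      (b ∈ E → ∃ k ∈ K, Conn H (U ∩ Eᶜ) a k))
      ⟨fun _ => Conn.refl ⟨h.1, ha⟩, fun h => absurd h ha⟩ ?_
    rintro x y hx ⟨h₁, h₂⟩ hxy hy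
    by_cases hxE : x ∈ E
    · obtain ⟨k, hk, hak⟩ := h₂ hxE
      refine ⟨fun hyE => ?_, fun _ => ⟨k, hk, hak⟩⟩
      have hyK : y ∈ K := by
        rcases hcov y with h | h | h
        · exact absurd ⟨hxE, h⟩ hxy.2.2
        · exact absurd h hyE
        · exact h
      by_cases hky : k = y
      · exact hky ▸ hak
      · exact hak.tail (hK hk hyK hky) ⟨hy, hyE⟩
    · refine ⟨fun hyE => (h₁ hxE).tail hxy.1 ⟨hy, hyE⟩, fun hyE => ⟨x, ?_, h₁ hxE⟩⟩
      rcases hcov x with h | h | h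
      · exact absurd ⟨h, hyE⟩ hxy.2.1
      · exact absurd h hxE
      · exact h
  exact key.1 hb

/-- For `w`, `p`, `q` outside `E`, the connection through the component can avoid `E`. There the cut
graph agrees with `H`, so simpliciality of `H` at `w` applies. -/
theorem adj_of_att_cut {D E K : Set V} {w c p q : V} (hH : IsChordal H) (hK : H.IsClique K)
    (hcov : ∀ x, x ∈ D ∨ x ∈ E ∨ x ∈ K) (hp : Att (cut H D E) (far (cut H D E) w) c p)
    (hq : Att (cut H D E) (far (cut H D E) w) c q)
    (hpq : p ≠ q) (hw : w ∉ E) (hpE : p ∉ E) (hqE : q ∉ E) : (cut H D E).Adj p q := by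
  rw [cut_adj_of_notMem hpE hqE]
  by_contra hadj
  have hwp := (adj_of_att_far hp).1
  have hwq := (adj_of_att_far hq).1
  obtain ⟨x, hx, hxp⟩ := hp.2
  obtain ⟨y, hy, hyq⟩ := hq.2
  have hconn : Conn (cut H D E) (far (cut H D E) w ∪ {p, q}) p q :=
    (((Conn.refl (by simp)).tail hxp.symm (.inl hx.mem_right)).trans
      ((hx.symm.trans hy).mono le_rfl Set.subset_union_left)).tail hyq (by simp)
  have hsub : (far (cut H D E) w ∪ {p, q}) ∩ Eᶜ ⊆ far H w ∪ {p, q} := by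
    rintro z ⟨hz | hz, hzE⟩
    · exact .inl ⟨hz.1, fun h => hz.2 ((cut_adj_of_notMem hw hzE).2 h)⟩
    · exact .inr hz
  obtain ⟨z, hzp, hzq⟩ := ((conn_of_conn_cut hK hcov hconn hpE hqE).mono le_rfl
    hsub).exists_att hpq hadj (fun h => h.2 hwp) (fun h => h.2 hwq)
  exact hadj (hH.simplicialAt w _ _ _ hzp hzq hpq)

/-- Removing all edges between two sides of a clique from a chordal graph leaves a chordal graph. -/
theorem IsChordal.cut {D E K : Set V} (hH : IsChordal H) (hK : H.IsClique K)
    (hcov : ∀ x, x ∈ D ∨ x ∈ E ∨ x ∈ K) (hKD : ∀ x ∈ K, x ∉ D) (hKE : ∀ x ∈ K, x ∉ E)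
    (hDE : ∀ x ∈ D, x ∉ E) : IsChordal (cut H D E) := by
  refine isChordal_of_simplicialAt fun w c p q hp hq hpq => ?_
  have hcov' : ∀ x, x ∈ E ∨ x ∈ D ∨ x ∈ K := fun x => by have := hcov x; tauto
  have core : w ∉ E → p ∉ E → q ∉ E → (FillIn.cut H D E).Adj p q :=
    adj_of_att_cut hH hK hcov hp hq hpq
  have core' : w ∉ D → p ∉ D → q ∉ D → (FillIn.cut H D E).Adj p q := by
    rw [cut_comm] at hp hq ⊢
    exact adj_of_att_cut hH hK hcov' hp hq hpq
  have hwp := adj_of_att_far hp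
  have hwq := adj_of_att_far hq
  -- The clique `K` lies in the closed neighbourhood of `w`, so the component misses `K` and stays
  -- on one side of the cut.
  have mixed : ∀ p q, Att (FillIn.cut H D E) (far (FillIn.cut H D E) w) c p →
      Att (FillIn.cut H D E) (far (FillIn.cut H D E) w) c q → w ∈ K → p ∈ D → q ∈ E → False := by
    intro p q hp hq hw hpD hqE
    obtain ⟨x, hx, hxp⟩ := hp.2
    obtain ⟨y, hy, hyq⟩ := hq.2
    have hfar : ∀ z ∈ far (FillIn.cut H D E) w, z ∉ K := fun z hz hzK =>
      hz.2 ((cut_adj_of_notMem (hKE w hw) (hKE z hzK)).2 (hK hw hzK (Ne.symm hz.1)))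
    have hsep : Sep (FillIn.cut H D E) D K := by
      intro x hx y hxy
      have := hcov y
      have := hxy.2.1
      tauto
    have hxD : x ∈ D := by
      have h₁ := hcov x
      have h₂ := hfar x hx.mem_right
      have h₃ := hxp.2.2
      tauto
    have hyD : y ∈ D := hsep.conn hxD (hx.symm.trans hy) hfar
    exact hyq.2.1 ⟨hyD, hqE⟩
  rcases hcov w with hw | hw | hw
  · exact core (hDE w hw) (fun h => hwp.2.1 ⟨hw, h⟩) (fun h => hwq.2.1 ⟨hw, h⟩)
  · exact core' (fun h => hDE w h hw) (fun h => hwp.2.2 ⟨hw, h⟩) (fun h => hwq.2.2 ⟨hw, h⟩)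
  · by_cases hpE : p ∈ E
    · by_cases hqD : q ∈ D
      · exact (mixed q p hq hp hw hqD hpE).elim
      · exact core' (hKD w hw) (fun h => hDE p h hpE) hqD
    · by_cases hqE : q ∈ E
      · by_cases hpD : p ∈ D
        · exact (mixed p q hp hq hw hpD hqE).elim
        · exact core' (hKD w hw) hpD (fun h => hDE q h hqE)
      · exact core (hKE w hw) hpE hqE

/-- Deleting the edge moves `v` to the far side of `u`. Components without `v` are as before. If the
component contains `v` and `p` is reached from another vertex of it, some component of `far H u` is
attached to both `v` and `p`, so simpliciality of `H` at `u` applies. -/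
theorem att_of_deleteEdges {u v c p : V} (hH : IsChordal H) (huv : H.Adj u v)
    (hp : Att (H.deleteEdges {s(u, v)}) (far (H.deleteEdges {s(u, v)}) u) c p) :
    (¬ Conn (H.deleteEdges {s(u, v)}) (far (H.deleteEdges {s(u, v)}) u) c v →
      Att H (far H u) c p) ∧
    (Conn (H.deleteEdges {s(u, v)}) (far (H.deleteEdges {s(u, v)}) u) c v → H.Adj v p) := by
  set J := H.deleteEdges {s(u, v)} with hJ
  have hJH : J ≤ H := SimpleGraph.deleteEdges_le _
  have hJadj : ∀ x y, H.Adj x y → ¬ (x = u ∧ y = v) → ¬ (x = v ∧ y = u) → J.Adj x y := by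
    intro x y hxy h₁ h₂
    simp [hJ, hxy, h₁, h₂]
  have hfar : ∀ x ∈ far J u, x ≠ v → x ∈ far H u := fun x hx hxv =>
    ⟨hx.1, fun h => hx.2 (hJadj u x h (fun h' => hxv h'.2) (fun h' => huv.ne h'.1))⟩
  have hup := hJH (adj_of_att_far hp)
  have hpfar : p ∉ far H u := fun h => h.2 hup
  obtain ⟨hpJ, x, hx, hxp⟩ := hp
  refine ⟨fun hv => ⟨hpfar, x, hx.of_forall (fun _ _ _ _ h => hJH h) fun y hy =>
    hfar y hy.mem_right ?_, hJH hxp⟩, fun hv => ?_⟩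
  · rintro rfl
    exact hv hy
  · by_cases hxv : x = v
    · exact hxv ▸ hJH hxp
    · obtain ⟨y, z, hy, hyz, hz, hzv⟩ := (hx.symm.trans hv).exit (P := {v}ᶜ) hxv (by simp)
      obtain rfl : z = v := by simpa using hzv
      have hy' : Conn H (far H u) x y := hy.mono hJH fun w hw => hfar w hw.1 hw.2
      refine hH.simplicialAt u x z p ⟨fun h => h.2 huv, y, hy', hJH hyz⟩
        ⟨hpfar, x, Conn.refl hy'.1, hJH hxp⟩ ?_
      rintro rfl
      exact hpJ hz

/-- Removing an edge whose ends have a clique of common neighbours from a chordal graph leaves a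
chordal graph. -/
theorem IsChordal.deleteEdge [Finite V] {u v : V} (hH : IsChordal H) (huv : H.Adj u v)
    (hW : H.IsClique {x | H.Adj x u ∧ H.Adj x v}) : IsChordal (H.deleteEdges {s(u, v)}) := by
  have hle : H.deleteEdges {s(u, v)} ≤ H := SimpleGraph.deleteEdges_le _
  have hJ : ∀ x y, (H.deleteEdges {s(u, v)}).Adj x y ↔
      H.Adj x y ∧ ¬ (x = u ∧ y = v) ∧ ¬ (x = v ∧ y = u) := by
    intro x y
    simp
  have atEnd : ∀ u v c p q, H.Adj u v → H.IsClique {x | H.Adj x u ∧ H.Adj x v} →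
      Att (H.deleteEdges {s(u, v)}) (far (H.deleteEdges {s(u, v)}) u) c p →
      Att (H.deleteEdges {s(u, v)}) (far (H.deleteEdges {s(u, v)}) u) c q → p ≠ q →
      H.Adj p q := by
    intro u v c p q huv hW hp hq hpq
    have hle : H.deleteEdges {s(u, v)} ≤ H := SimpleGraph.deleteEdges_le _
    have h₁ := att_of_deleteEdges hH huv hp
    have h₂ := att_of_deleteEdges hH huv hq
    by_cases hv : Conn (H.deleteEdges {s(u, v)}) (far (H.deleteEdges {s(u, v)}) u) c v
    · exact hW ⟨(hle (adj_of_att_far hp)).symm, (h₁.2 hv).symm⟩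
        ⟨(hle (adj_of_att_far hq)).symm, (h₂.2 hv).symm⟩ hpq
    · exact hH.simplicialAt u c p q (h₁.1 hv) (h₂.1 hv) hpq
  refine isChordal_of_simplicialAt fun w c p q hp hq hpq => ?_
  have hwp := adj_of_att_far hp
  have hwq := adj_of_att_far hq
  have hadj : H.Adj p q := by
    by_cases hwu : w = u
    · subst hwu
      exact atEnd w v c p q huv hW hp hq hpq
    by_cases hwv : w = v
    · subst hwv
      rw [Sym2.eq_swap] at hp hq
      exact atEnd w u c p q huv.symm (by simpa only [and_comm] using hW) hp hq hpq
    have hfar : far (H.deleteEdges {s(u, v)}) w ⊆ far H w := fun x hx =>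
      ⟨hx.1, fun h => hx.2 ((hJ w x).2 ⟨h, fun h => hwu h.1, fun h => hwv h.1⟩)⟩
    exact hH.simplicialAt w c p q (hp.mono hle hfar fun h => h.2 (hle hwp))
      (hq.mono hle hfar fun h => h.2 (hle hwq)) hpq
  -- If a component were attached to both ends of the deleted edge, some vertex `x` of its connected
  -- set in `H` would be adjacent to both ends. Then `x` and `w` are common neighbours, hence
  -- adjacent, although `x` is far from `w`.
  have bad : ∀ p q, Att (H.deleteEdges {s(u, v)}) (far (H.deleteEdges {s(u, v)}) w) c p →
      Att (H.deleteEdges {s(u, v)}) (far (H.deleteEdges {s(u, v)}) w) c q →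
      ¬ (p = u ∧ q = v) := by
    rintro p q hp hq ⟨rfl, rfl⟩
    have hwp := hle (adj_of_att_far hp)
    have hwq := hle (adj_of_att_far hq)
    obtain ⟨x, hx, hxK⟩ := hH.exists_adj_of_isClique (K := {p, q}) (U := far _ w)
      (by simpa [SimpleGraph.isClique_pair] using fun _ => huv) hp.mem (by
        rintro k (rfl | rfl)
        · exact hp.mono hle le_rfl hp.1
        · exact hq.mono hle le_rfl hq.1)
    have hxw := hx.mem_right
    have : H.Adj w x := hW ⟨hwp, hwq⟩ ⟨hxK p (by simp), hxK q (by simp)⟩ hxw.1.symm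
    exact hxw.2 ((hJ w x).2 ⟨this, fun h => hwp.ne h.1, fun h => hwq.ne h.1⟩)
  exact (hJ p q).2 ⟨hadj, bad p q hp hq, fun h => bad q p hq hp h.symm⟩

/-! ### Minimal triangulations -/

theorem isChordal_top : IsChordal (⊤ : SimpleGraph V) :=
  isChordal_of_simplicialAt fun _ _ _ _ _ _ h => h

theorem exists_minimalTriangulation_le [Finite V] (h : IsTriangulation G H) :
    ∃ H' ≤ H, IsMinimalTriangulation G H' := by
  obtain ⟨H', hle, hmin⟩ := exists_minimal_le_of_wellFoundedLT (IsTriangulation G) H h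
  exact ⟨H', hle, hmin⟩

/-- A minimal triangulation adds no edges between different sides of a clique. -/
theorem IsMinimalTriangulation.sep {D K : Set V} (hH : IsMinimalTriangulation G H)
    -- Cutting all edges from `D` to the vertices outside `D ∪ K` keeps `H` chordal and loses no
    -- edge of `G`, so by minimality there are none.
    (hK : H.IsClique K) (hKD : ∀ x ∈ K, x ∉ D) (hsep : Sep G D K) : Sep H D K := by
  have hc : IsChordal (cut H D {x | x ∉ D ∧ x ∉ K}) := hH.1.2.cut hK
    (fun x => by by_cases x ∈ D <;> by_cases x ∈ K <;> simp_all) hKD (fun x hx h => h.2 hx)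
    fun x hx h => h.1 hx
  have hG : G ≤ cut H D {x | x ∉ D ∧ x ∉ K} := by
    refine fun x y hxy => ⟨hH.1.1 hxy, fun h => ?_, fun h => ?_⟩
    · rcases hsep x h.1 y hxy with h' | h'
      · exact h.2.1 h'
      · exact h.2.2 h'
    · rcases hsep y h.2 x hxy.symm with h' | h'
      · exact h.1.1 h'
      · exact h.1.2 h'
  intro x hx y hxy
  have := (hH.2 ⟨hG, hc⟩ (cut_le _ _ _) hxy).2.1
  simp only [Set.mem_ofPred_eq] at this
  tauto

theorem IsMinimalTriangulation.sep_component {Ω : Set V} {c : V} (hH : IsMinimalTriangulation G H)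
    (hΩ : H.IsClique Ω) : Sep H {v | Conn G Ωᶜ c v} {v | Att G Ωᶜ c v} :=
  hH.sep (hΩ.subset fun _ hx => not_not.1 hx.1) (fun _ hx h => hx.1 h.mem_right)
    (FillIn.sep_component _ _ _)

/-! ### Potential maximal cliques -/

/-- No component of the complement of `Ω` is attached to all of `Ω`. -/
def NoFull (G : SimpleGraph V) (Ω : Set V) : Prop := ∀ c ∉ Ω, ∃ w ∈ Ω, ¬ Att G Ωᶜ c w

/-- Nonadjacent vertices of `Ω` are attached to a common component. -/
def Cliquish (G : SimpleGraph V) (Ω : Set V) : Prop :=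
  ∀ u ∈ Ω, ∀ v ∈ Ω, u ≠ v → G.Adj u v ∨ ∃ c ∉ Ω, Att G Ωᶜ c u ∧ Att G Ωᶜ c v

/-- A component attached to all of `Ω` contains a vertex that is adjacent in `H` to all of `Ω`, by
`IsChordal.exists_adj_of_isClique`. -/
theorem noFull_of_maximal [Finite V] {Ω : Set V} (hH : IsTriangulation G H) (hΩ : H.IsClique Ω)
    (hmax : ∀ x ∉ Ω, ∃ w ∈ Ω, ¬ H.Adj x w) : NoFull G Ω := by
  intro c hc
  by_contra! hfull
  obtain ⟨x, hx, hxΩ⟩ := hH.2.exists_adj_of_isClique hΩ (U := Ωᶜ) hc fun k hk =>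
    (hfull k hk).mono hH.1 le_rfl (not_not.2 hk)
  obtain ⟨w, hw, hxw⟩ := hmax x hx.mem_right
  exact hxw (hxΩ w hw)

/-- Otherwise all common neighbours of `u` and `v` in `H` lie in the clique `Ω`: the component in
`G` of one outside would be attached to both. Then the fill edge `uv` can be deleted, against
minimality. -/
theorem cliquish_of_isMinimalTriangulation [Finite V] {Ω : Set V}
    (hH : IsMinimalTriangulation G H) (hΩ : H.IsClique Ω) : Cliquish G Ω := by
  intro u hu v hv huv
  by_contra! hcon
  obtain ⟨hadj, hatt⟩ := hcon
  have hcommon : ∀ x, H.Adj x u → H.Adj x v → x ∈ Ω := by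
    intro x hxu hxv
    by_contra hx
    have hsep := hH.sep_component (c := x) hΩ
    have key : ∀ y ∈ Ω, H.Adj x y → Att G Ωᶜ x y := fun y hy hxy =>
      (hsep x (Conn.refl hx) y hxy).resolve_left fun h => h.mem_right hy
    exact hatt x hx (key u hu hxu) (key v hv hxv)
  have hc := hH.1.2.deleteEdge (hΩ hu hv huv) (hΩ.subset fun x hx => hcommon x hx.1 hx.2)
  have hG : G ≤ H.deleteEdges {s(u, v)} := by
    intro x y hxy
    have := hH.1.1 hxy
    rw [SimpleGraph.deleteEdges_adj]
    refine ⟨this, fun h => hadj ?_⟩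
    rw [Set.mem_singleton_iff] at h
    rw [← SimpleGraph.mem_edgeSet, ← h]
    exact hxy
  have := hH.2 ⟨hG, hc⟩ (SimpleGraph.deleteEdges_le _) (hΩ hu hv huv)
  simp at this

/-- Take a minimal triangulation `H` of `G` with `Ω` completed, and below it a minimal triangulation
`H'` of `G`. Once `Ω` is known to be a clique of `H'`, minimality of `H` gives `H = H'`. -/
theorem exists_isMinimalTriangulation [Finite V] {Ω : Set V} (h₁ : NoFull G Ω)
    (h₂ : Cliquish G Ω) : ∃ H, IsMinimalTriangulation G H ∧ H.IsClique Ω ∧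
      ∀ x ∉ Ω, ∃ w ∈ Ω, ¬ H.Adj x w := by
  obtain ⟨H, -, hH⟩ := exists_minimalTriangulation_le (G := G ⊔ SimpleGraph.fromRel
    fun x y => x ∈ Ω ∧ y ∈ Ω) ⟨le_top, isChordal_top⟩
  have hΩ : H.IsClique Ω := fun x hx y hy hxy => hH.1.1 (by simp [hxy, hx, hy])
  have hadjΩ : ∀ x ∉ Ω, ∀ y, (G ⊔ SimpleGraph.fromRel fun x y => x ∈ Ω ∧ y ∈ Ω).Adj x y →
      G.Adj x y := by
    intro x hx y
    simp [hx]
  have hsep : ∀ c, Sep H {v | Conn G Ωᶜ c v} {v | Att G Ωᶜ c v} := fun c =>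
    hH.sep (hΩ.subset fun _ hx => not_not.1 hx.1) (fun _ hx h => hx.1 h.mem_right) fun x hx y hxy =>
      sep_component G Ωᶜ c x hx y (hadjΩ x hx.mem_right y hxy)
  obtain ⟨H', hle, hH'⟩ := exists_minimalTriangulation_le (G := G) (H := H)
    ⟨le_sup_left.trans hH.1.1, hH.1.2⟩
  have hΩ' : H'.IsClique Ω := by
    intro u hu v hv huv
    rcases h₂ u hu v hv huv with h | ⟨c, hc, hcu, hcv⟩
    · exact hH'.1.1 h
    obtain ⟨w, hw, hcw⟩ := h₁ c hc
    have hsub : Ωᶜ ⊆ {v | ¬ Att G Ωᶜ c v} := fun x hx h => h.1 hx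
    -- The neighbourhood of the component of `c` in `G` is attached to two components of its
    -- complement in `H'`, those of `c` and of the missed vertex `w`. Hence `u` and `v` are adjacent
    -- in `H'`.
    have up : ∀ x, Att G Ωᶜ c x → Att H' {v | ¬ Att G Ωᶜ c v} c x := fun x hx =>
      hx.mono hH'.1.1 hsub (not_not.2 hx)
    have side : ∀ x ∈ Ω, Att G Ωᶜ c x → Att H' {v | ¬ Att G Ωᶜ c v} w x := by
      intro x hx hcx
      have hwx : w ≠ x := by rintro rfl; exact hcw hcx
      rcases h₂ w hw x hx hwx with h | ⟨d, -, hdw, hdx⟩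
      · exact ⟨not_not.2 hcx, w, Conn.refl hcw, hH'.1.1 h⟩
      · obtain ⟨y, hy, hyw⟩ := hdw.2
        obtain ⟨z, hz, hzx⟩ := hdx.2
        refine ⟨not_not.2 hcx, z, ?_, hH'.1.1 hzx⟩
        exact ((Conn.refl hcw).tail (hH'.1.1 hyw.symm) (hsub hy.mem_right)).trans
          ((hy.symm.trans hz).mono hH'.1.1 hsub)
    refine hH'.1.2.adj_of_att (up u hcu) (up v hcv) (side u hu hcu) (side v hv hcv) ?_ huv
    intro h
    have hsep' : Sep H' {v | Conn G Ωᶜ c v} {v | Att G Ωᶜ c v} := fun x hx y hxy =>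
      hsep c x hx y (hle hxy)
    exact (hsep'.conn (Conn.refl hc) h fun x hx => hx : Conn G Ωᶜ c w).mem_right hw
  have hle' : H ≤ H' := hH.2 ⟨sup_le hH'.1.1 fun x y hxy => by
    simp only [SimpleGraph.fromRel_adj] at hxy
    exact hΩ' (by tauto) (by tauto) hxy.1, hH'.1.2⟩ hle
  obtain rfl := le_antisymm hle hle'
  refine ⟨H', hH', hΩ, fun x hx => ?_⟩
  obtain ⟨w, hw, hxw⟩ := h₁ x hx
  exact ⟨w, hw, fun h => hxw ((hsep x x (Conn.refl hx) w h).resolve_left fun h =>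
    h.mem_right hw)⟩

/-- The characterization of potential maximal cliques of Bouchitté and Todinca. -/
theorem isPotentialMaximalClique_iff [Finite V] (Ω : Finset V) :
    IsPotentialMaximalClique G Ω ↔ NoFull G (Ω : Set V) ∧ Cliquish G (Ω : Set V) := by
  classical
  constructor
  · rintro ⟨H, hH, hΩ, hmax⟩
    refine ⟨noFull_of_maximal hH.1 hΩ fun x hx => ?_, cliquish_of_isMinimalTriangulation hH hΩ⟩
    by_contra! hcon
    have : H.IsClique ((insert x Ω : Finset V) : Set V) := by
      rw [Finset.coe_insert]
      exact hΩ.insert fun b hb _ => hcon b hb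
    exact hx (hmax this (Finset.subset_insert _ _) (Finset.mem_insert_self _ _))
  · rintro ⟨h₁, h₂⟩
    obtain ⟨H, hH, hΩ, hmax⟩ := exists_isMinimalTriangulation h₁ h₂
    refine ⟨H, hH, hΩ, fun K hK hle x hx => ?_⟩
    by_contra hxΩ
    obtain ⟨w, hw, hxw⟩ := hmax x hxΩ
    exact hxw (hK hx (hle hw) fun h => hxΩ (h ▸ hw))

end MinimalTriangulations

end FillIn

/-! ### Safe triangulations and the shape of a quasi-clique -/

namespace FillIn

section Fill

variable {V : Type*} {A G H : SimpleGraph V} {D K Ω Z : Set V} {v w : V}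

/-! ### A triangulation respecting all clique separators -/

/-- The neighbourhoods of the components outside the closed neighbourhood of `w` are completed. -/
def completeAt (H : SimpleGraph V) (w : V) : SimpleGraph V where
  Adj i j := H.Adj i j ∨ (i ≠ j ∧ ∃ c, Att H (far H w) c i ∧ Att H (far H w) c j)
  symm := ⟨fun _ _ h => h.imp SimpleGraph.Adj.symm fun h => ⟨h.1.symm, h.2.imp fun _ h => h.symm⟩⟩
  loopless := ⟨fun _ h => h.elim (fun h => h.ne rfl) fun h => h.1 rfl⟩

theorem le_completeAt (H : SimpleGraph V) (w : V) : H ≤ completeAt H w := fun _ _ h => .inl h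

/-- If the new edges at `far H v` stay within components and their neighbourhoods, then these are
unchanged. -/
theorem att_of_att_completeAt (hsep : ∀ i j, (completeAt H w).Adj i j → i ∈ far H v →
    Conn H (far H v) i j ∨ Att H (far H v) i j) {c p : V}
    (h : Att (completeAt H w) (far (completeAt H w) v) c p) : Att H (far H v) c p := by
  have hfar : far (completeAt H w) v = far H v := by
    refine Set.Subset.antisymm (fun j hj => ⟨hj.1, fun h => hj.2 (.inl h)⟩) fun j hj =>
      ⟨hj.1, fun h => ?_⟩
    rcases hsep j v h.symm hj with h | h
    · exact h.mem_right.1 rfl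
    · obtain ⟨u, hu, huv⟩ := h.2
      exact hu.mem_right.2 huv.symm
  rw [hfar] at h
  obtain ⟨hp, u, hu, hup⟩ := h
  have hu' : Conn H (far H v) c u := hu.induction (P := fun u => Conn H (far H v) c u)
    (Conn.refl hu.1) fun x y hx ih hxy hy =>
      ih.trans ((hsep x y hxy hx.mem_right).resolve_right fun h => h.1 hy)
  exact ((hsep u p hup hu.mem_right).resolve_left fun h => hp h.mem_right).of_conn hu'

theorem simplicialAt_completeAt_self (H : SimpleGraph V) (w : V) :
    SimplicialAt (completeAt H w) w := by
  intro c p q hp hq hpq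
  have hsep : ∀ i j, (completeAt H w).Adj i j → i ∈ far H w →
      Conn H (far H w) i j ∨ Att H (far H w) i j := by
    rintro i j (hij | ⟨-, c, hi, -⟩) hif
    · exact sep_component H _ i i (Conn.refl hif) j hij
    · exact absurd hif hi.1
  exact .inr ⟨hpq, c, att_of_att_completeAt hsep hp, att_of_att_completeAt hsep hq⟩

/-- Let `i` in `far H v` be an end of a new edge `ij`; both ends are adjacent to `w`. If `w` is in
the component of `i`, then `j` is in it or attached to it. Otherwise `w` belongs to the clique of
attachments, so the component far from `w` that created `ij` avoids this clique. It then lies inside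
the component of `i`, and `j` is again in it or attached to it. -/
theorem SimplicialAt.completeAt (hv : SimplicialAt H v) (w : V) :
    SimplicialAt (completeAt H w) v := by
  have hsep : ∀ i j, (FillIn.completeAt H w).Adj i j → i ∈ far H v →
      Conn H (far H v) i j ∨ Att H (far H v) i j := by
    rintro i j (hij | ⟨hij, c, hi, hj⟩) hif
    · exact sep_component H _ i i (Conn.refl hif) j hij
    have hwi := adj_of_att_far hi
    have hwj := adj_of_att_far hj
    rcases sep_component H _ i i (Conn.refl hif) w hwi.symm with hw | hw
    · exact sep_component H _ i w hw j hwj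
    · have hno : ∀ x ∈ far H w, x ∉ {x | Att H (far H v) i x} := fun x hx hxi =>
        hx.2 (hv i w x hw hxi hx.1.symm)
      obtain ⟨x, hx, hxi⟩ := hi.2
      obtain ⟨y, hy, hyj⟩ := hj.2
      have hxD := (sep_component H (far H v) i i (Conn.refl hif) x hxi.symm).resolve_right
        (hno x hx.mem_right)
      exact sep_component H _ i y ((sep_component H (far H v) i).conn hxD (hx.symm.trans hy) hno)
        j hyj
  exact fun c p q hp hq hpq => le_completeAt H w
    (hv c p q (att_of_att_completeAt hsep hp) (att_of_att_completeAt hsep hq) hpq)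

theorem Sep.completeAt (h : Sep H D K) (hK : H.IsClique K) (w : V) :
    Sep (completeAt H w) D K := by
  rintro i hiD j (hij | ⟨hij, c, hi, hj⟩)
  · exact h i hiD j hij
  have hwi := adj_of_att_far hi
  have hwj := adj_of_att_far hj
  rcases h i hiD w hwi.symm with hw | hw
  · exact h w hw j hwj
  · have hno : ∀ x ∈ far H w, x ∉ K := fun x hx hxK => hx.2 (hK hw hxK hx.1.symm)
    obtain ⟨x, hx, hxi⟩ := hi.2
    obtain ⟨y, hy, hyj⟩ := hj.2
    have hxD := (h i hiD x hxi.symm).resolve_right (hno x hx.mem_right)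
    exact h y (h.conn hxD (hx.symm.trans hy) hno) j hyj

/-- `H` is a triangulation of `A` without edges between different sides of a clique of `A`. -/
structure IsSafeTriangulation (A H : SimpleGraph V) : Prop where
  le : A ≤ H
  chordal : IsChordal H
  sep : ∀ D K : Set V, A.IsClique K → Sep A D K → Sep H D K

/-- One pass over the vertices suffices, because later completions preserve simpliciality at the
vertices already treated. -/
theorem isSafeTriangulation_foldl (A : SimpleGraph V) (l : List V) (hl : ∀ v, v ∈ l) :
    IsSafeTriangulation A (l.foldl completeAt A) := by
  have key : ∀ l : List V, A ≤ l.foldl completeAt A ∧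
      (∀ v ∈ l, SimplicialAt (l.foldl completeAt A) v) ∧
      ∀ D K : Set V, A.IsClique K → Sep A D K → Sep (l.foldl completeAt A) D K := by
    intro l
    induction l using List.reverseRecOn with
    | nil => exact ⟨le_rfl, by simp, fun _ _ _ h => h⟩
    | append_singleton l w ih =>
      rw [List.foldl_append, List.foldl_cons, List.foldl_nil]
      refine ⟨ih.1.trans (le_completeAt _ _), fun v hv => ?_, fun D K hK h =>
        (ih.2.2 D K hK h).completeAt (hK.mono ih.1) w⟩
      rcases List.mem_append.1 hv with hv | hv
      · exact (ih.2.1 v hv).completeAt w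
      · rw [List.mem_singleton.1 hv]
        exact simplicialAt_completeAt_self _ _
  obtain ⟨h₁, h₂, h₃⟩ := key l
  exact ⟨h₁, isChordal_of_simplicialAt fun v => h₂ v (hl v), h₃⟩

/-! ### Reconstruction of quasi-cliques -/

/-- The graph obtained by removing all edges at vertices of `Z`. -/
def isolateAt (G : SimpleGraph V) (Z : Set V) : SimpleGraph V where
  Adj i j := G.Adj i j ∧ i ∉ Z ∧ j ∉ Z
  symm := ⟨fun _ _ h => ⟨h.1.symm, h.2.symm⟩⟩
  loopless := ⟨fun _ h => h.1.ne rfl⟩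

/-- The common closed neighbours of `x` and `y` whose closed neighbourhood contains all common
neighbours of `u` and `v`. -/
def pickSet (H : SimpleGraph V) (u v x y : V) : Set V :=
  {w | (x = w ∨ H.Adj x w) ∧ (y = w ∨ H.Adj y w) ∧
    ∀ s, H.Adj u s → H.Adj v s → w = s ∨ H.Adj w s}

theorem conn_isolateAt {c v : V} {Z' : Set V} (hZ : Z' ⊆ Ω) (h : Conn G Ωᶜ c v) :
    Conn (isolateAt G Z') Ωᶜ c v :=
  h.of_forall (fun _ _ hx hy hxy =>
    ⟨hxy, fun h => hx.mem_right (hZ h), fun h => hy.mem_right (hZ h)⟩) fun _ hx => hx.mem_right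

/-- The vertex `z` of `Ω` missed by the component of `c` must lie in `Z`. With `Z \ {z}` isolated,
the clique `Ω \ Z` separates `c` from `z`, also in `H`. Both sides are attached to all of it, on the
side of `z` because `Ω` is cliquish. So each side has a vertex adjacent to the whole clique, and
their common neighbours are exactly the clique. -/
theorem eq_pickSet_of_full [Finite V] (h₁ : NoFull G Ω) (h₂ : Cliquish G Ω) (hZ : Z ⊆ Ω)
    (hX : G.IsClique (Ω \ Z)) {c : V} (hc : c ∉ Ω) (hfull : ∀ x ∈ Ω \ Z, Att G Ωᶜ c x) :
    ∃ Z' ⊆ Z, ∃ z ∈ Z, Z = Z' ∪ {z} ∧ ∀ H, IsSafeTriangulation (isolateAt G Z') H →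
      ∃ u v, Ω \ Z = pickSet H u v u v := by
  obtain ⟨z, hzΩ, hcz⟩ := h₁ c hc
  have hzZ : z ∈ Z := by
    by_contra h
    exact hcz (hfull z ⟨hzΩ, h⟩)
  have hZ'Ω : Z \ {z} ⊆ Ω := fun x hx => hZ hx.1
  refine ⟨Z \ {z}, Set.sdiff_subset, z, hzZ, by simp [hzZ], fun H hH => ?_⟩
  set A := isolateAt G (Z \ {z}) with hA
  have hXA : A.IsClique (Ω \ Z) := fun x hx y hy hxy =>
    ⟨hX hx hy hxy, fun h => hx.2 h.1, fun h => hy.2 h.1⟩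
  have hsub : Ωᶜ ⊆ (Ω \ Z)ᶜ := Set.compl_subset_compl.2 Set.sdiff_subset
  have hD : Sep A {v | Conn G Ωᶜ c v} (Ω \ Z) := by
    intro x hx y hxy
    refine (sep_component G Ωᶜ c x hx y hxy.1).imp_right fun hy => ⟨not_not.1 hy.1, fun hyZ => ?_⟩
    refine hxy.2.2 ⟨hyZ, ?_⟩
    rintro rfl
    exact hcz hy
  have hE : Sep A {v | Conn A (Ω \ Z)ᶜ z v} (Ω \ Z) := fun x hx y hxy =>
    (sep_component A (Ω \ Z)ᶜ z x hx y hxy).imp_right fun h => not_not.1 h.1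
  have hDE : ∀ x, Conn G Ωᶜ c x → ¬ Conn A (Ω \ Z)ᶜ z x := fun x hx hzx =>
    (hD.conn hx hzx.symm fun y hy => hy : Conn G Ωᶜ c z).mem_right hzΩ
  have hDH := hH.sep _ _ hXA hD
  have hEH := hH.sep _ _ hXA hE
  have hzX : z ∈ (Ω \ Z)ᶜ := fun h => h.2 hzZ
  have hXH : H.IsClique (Ω \ Z) := hXA.mono hH.le
  have hout : ∀ y ∉ Ω, y ∉ Z \ {z} := fun y hy h => hy (hZ'Ω h)
  have hin : ∀ y ∈ Ω \ Z, y ∉ Z \ {z} := fun y hy h => hy.2 h.1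
  have hattc : ∀ k ∈ Ω \ Z, Att H (Ω \ Z)ᶜ c k := by
    intro k hk
    obtain ⟨y, hy, hyk⟩ := (hfull k hk).2
    exact ⟨not_not.2 hk, y, (conn_isolateAt hZ'Ω hy).mono hH.le hsub,
      hH.le ⟨hyk, hout y hy.mem_right, hin k hk⟩⟩
  have hattz : ∀ k ∈ Ω \ Z, Att H (Ω \ Z)ᶜ z k := by
    intro k hk
    have hzk : z ≠ k := by rintro rfl; exact hk.2 hzZ
    rcases h₂ z hzΩ k hk.1 hzk with h | ⟨d, hd, hdz, hdk⟩
    · exact ⟨not_not.2 hk, z, Conn.refl hzX, hH.le ⟨h, fun h => h.2 rfl, hin k hk⟩⟩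
    · obtain ⟨y, hy, hyz⟩ := hdz.2
      obtain ⟨y', hy', hyk⟩ := hdk.2
      refine ⟨not_not.2 hk, y', ?_, hH.le ⟨hyk, hout y' hy'.mem_right, hin k hk⟩⟩
      exact ((Conn.refl hzX).tail (hH.le ⟨hyz.symm, fun h => h.2 rfl, hout y hy.mem_right⟩)
        (hsub hy.mem_right)).trans ((conn_isolateAt hZ'Ω (hy.symm.trans hy')).mono hH.le hsub)
  obtain ⟨u, hu, huX⟩ := hH.chordal.exists_adj_of_isClique hXH (hsub hc) hattc
  obtain ⟨v, hv, hvX⟩ := hH.chordal.exists_adj_of_isClique hXH hzX hattz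
  have huD : Conn G Ωᶜ c u := hDH.conn (Conn.refl hc) hu fun y hy => hy
  have hvE : Conn A (Ω \ Z)ᶜ z v := hEH.conn (Conn.refl hzX) hv fun y hy => hy
  have hcommon : ∀ s, (u = s ∨ H.Adj u s) → (v = s ∨ H.Adj v s) → s ∈ Ω \ Z := by
    intro s hus hvs
    have h₁ : Conn G Ωᶜ c s ∨ s ∈ Ω \ Z := by
      rcases hus with rfl | h
      · exact .inl huD
      · exact hDH u huD s h
    have h₂ : Conn A (Ω \ Z)ᶜ z s ∨ s ∈ Ω \ Z := by
      rcases hvs with rfl | h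
      · exact .inl hvE
      · exact hEH v hvE s h
    have := hDE s
    tauto
  refine ⟨u, v, Set.Subset.antisymm (fun w hw => ⟨.inr (huX w hw), .inr (hvX w hw),
    fun s hus hvs => ?_⟩) fun w hw => hcommon w hw.1 hw.2.1⟩
  by_cases hws : w = s
  · exact .inl hws
  · exact .inr (hXH hw (hcommon s (.inr hus) (.inr hvs)) hws)

/-- Let `c` have the largest set `S` of attachments in `Ω \ Z`, let `x` be a vertex of `Ω \ Z`
missed by it, and let `u` in its component be adjacent in `H` to all of `S`. The common neighbours
of `u` and `x` are then `S`. A neighbour of `x` outside `Ω` that is adjacent to all of `S` would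
have a component attached to `S` and `x`, more than the maximum. If there is no vertex outside `Ω`,
a closed neighbourhood in `H` is enough. -/
theorem eq_pickSet_of_noFull [Finite V] (hZ : Z ⊆ Ω) (hX : G.IsClique (Ω \ Z))
    (hno : ∀ c ∉ Ω, ∃ x ∈ Ω \ Z, ¬ Att G Ωᶜ c x) (hne : (Ω \ Z).Nonempty) :
    ∃ z ∈ Ω, ∀ H, IsSafeTriangulation (isolateAt G Z) H →
      ∃ u v, Ω \ Z = pickSet H u v z z := by
  have hXA : (isolateAt G Z).IsClique (Ω \ Z) := fun x hx y hy hxy =>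
    ⟨hX hx hy hxy, hx.2, hy.2⟩
  have isolated : ∀ H, IsSafeTriangulation (isolateAt G Z) H → ∀ x y, H.Adj x y → y ∉ Z := by
    intro H hH x y hxy hy
    have h : Sep (isolateAt G Z) {y} ∅ := by
      rintro _ rfl w hw
      exact absurd hy hw.2.1
    rcases hH.sep _ _ (by simp) h y rfl x hxy.symm with h | h
    · exact hxy.ne h
    · exact h
  by_cases huniv : ∀ c, c ∈ Ω
  · obtain ⟨x, hx⟩ := hne
    refine ⟨x, hx.1, fun H hH => ⟨x, x, ?_⟩⟩
    have hXH : H.IsClique (Ω \ Z) := hXA.mono hH.le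
    refine Set.Subset.antisymm (fun w hw => ?_) fun w hw => ?_
    · have hxw : x = w ∨ H.Adj x w := or_iff_not_imp_left.2 fun h => hXH hx hw h
      exact ⟨hxw, hxw, fun s hs _ => or_iff_not_imp_left.2 fun h =>
        hXH hw ⟨huniv s, isolated H hH x s hs⟩ h⟩
    · rcases hw.1 with rfl | h
      · exact hx
      · exact ⟨huniv w, isolated H hH x w h⟩
  push Not at huniv
  obtain ⟨c, hc, hmax⟩ := Set.exists_max_image Ωᶜ
    (fun c => {k ∈ Ω \ Z | Att G Ωᶜ c k}.ncard) (Set.toFinite _) huniv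
  obtain ⟨x, hx, hcx⟩ := hno c hc
  refine ⟨x, hx.1, fun H hH => ?_⟩
  have hXH : H.IsClique (Ω \ Z) := hXA.mono hH.le
  have hsep : ∀ d, Sep H {v | Conn G Ωᶜ d v} {k ∈ Ω \ Z | Att G Ωᶜ d k} := fun d =>
    hH.sep _ _ (hXA.subset fun _ h => h.1) fun a ha b hab =>
      (sep_component G Ωᶜ d a ha b hab.1).imp_right fun h => ⟨⟨not_not.1 h.1, hab.2.2⟩, h⟩
  obtain ⟨u, hu, huS⟩ := hH.chordal.exists_adj_of_isClique (U := Ωᶜ)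
    (hXH.subset fun k (hk : k ∈ {k ∈ Ω \ Z | Att G Ωᶜ c k}) => hk.1) hc (by
      rintro k ⟨hk, hck⟩
      obtain ⟨y, hy, hyk⟩ := hck.2
      exact ⟨hck.1, y, (conn_isolateAt hZ hy).mono hH.le le_rfl,
        hH.le ⟨hyk, fun h => hy.mem_right (hZ h), hk.2⟩⟩)
  have huD : Conn G Ωᶜ c u := (hsep c).conn (Conn.refl hc) hu fun y hy h => hy h.1.1
  refine ⟨u, x, Set.Subset.antisymm (fun w hw => ?_) fun w hw => ?_⟩
  · have hxw : x = w ∨ H.Adj x w := or_iff_not_imp_left.2 fun h => hXH hx hw h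
    refine ⟨hxw, hxw, fun s hus hxs => or_iff_not_imp_left.2 fun h => ?_⟩
    rcases hsep c u huD s hus with hs | hs
    · rcases hsep c s hs x hxs.symm with h | h
      · exact absurd hx.1 h.mem_right
      · exact absurd h.2 hcx
    · exact hXH hw hs.1 h
  · by_contra hwX
    have hxw : H.Adj x w := hw.1.resolve_left fun h => hwX (h ▸ hx)
    have hwΩ : w ∉ Ω := fun h => hwX ⟨h, isolated H hH x w hxw⟩
    have key : ∀ s ∈ Ω \ Z, H.Adj w s → s ∈ {k ∈ Ω \ Z | Att G Ωᶜ w k} := fun s hs h =>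
      (hsep w w (Conn.refl hwΩ) s h).resolve_left fun h => h.mem_right hs.1
    refine absurd (hmax w hwΩ) (not_le.2 (Set.ncard_lt_ncard ?_ (Set.toFinite _)))
    refine ⟨fun s hs => key s hs.1 ?_, fun h => hcx (h (key x hx hxw.symm)).2⟩
    have hxs : x ≠ s := by rintro rfl; exact hcx hs.2
    refine (hw.2.2 s (huS s hs) (hXH hx hs.1 hxs)).resolve_left ?_
    rintro rfl
    exact hwX hs.1

/-- A potential maximal clique that is a clique up to a set `Z` is determined by a subset of `Z`
and five vertices. -/
theorem exists_eq_pickSet [Finite V] (h₁ : NoFull G Ω) (h₂ : Cliquish G Ω) (hZ : Z ⊆ Ω)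
    (hX : G.IsClique (Ω \ Z)) : Ω = Z ∨ ∃ Z' ⊆ Z, ∀ H, IsSafeTriangulation (isolateAt G Z') H →
      ∃ u v x y z, Ω = Z' ∪ ({z} ∪ pickSet H u v x y) := by
  by_cases hfull : ∃ c ∉ Ω, ∀ x ∈ Ω \ Z, Att G Ωᶜ c x
  · obtain ⟨c, hc, hfull⟩ := hfull
    obtain ⟨Z', hZ', z, -, hZz, h⟩ := eq_pickSet_of_full h₁ h₂ hZ hX hc hfull
    refine .inr ⟨Z', hZ', fun H hH => ?_⟩
    obtain ⟨u, v, huv⟩ := h H hH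
    refine ⟨u, v, u, v, z, ?_⟩
    rw [← Set.union_assoc, ← hZz, ← huv, Set.union_sdiff_cancel hZ]
  · push Not at hfull
    rcases (Ω \ Z).eq_empty_or_nonempty with h | hne
    · exact .inl (Set.Subset.antisymm (Set.sdiff_eq_empty.1 h) hZ)
    · obtain ⟨z, hz, h⟩ := eq_pickSet_of_noFull hZ hX hfull hne
      refine .inr ⟨Z, le_rfl, fun H hH => ?_⟩
      obtain ⟨u, v, huv⟩ := h H hH
      refine ⟨u, v, z, z, z, ?_⟩
      rw [← huv, Set.union_left_comm, Set.union_sdiff_cancel hZ,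
        Set.union_eq_self_of_subset_left (Set.singleton_subset_iff.2 hz)]

end Fill

end FillIn

/-! ### The bit-level program computes the graph-theoretic notions -/

namespace FillIn

namespace Alg

variable {n : ℕ} {G : SimpleGraph (Fin n)} {U s Z Ω : Set (Fin n)}

/-! ### Correctness of the algorithm -/

open Classical in
/-- The bit vector of a set of vertices. -/
noncomputable def vec (s : Set (Fin n)) : List Bool := List.ofFn fun i => decide (i ∈ s)

open Classical in
/-- The adjacency matrix of a graph. -/
noncomputable def mat (G : SimpleGraph (Fin n)) : List (List Bool) :=
  List.ofFn fun i => List.ofFn fun j => decide (G.Adj i j)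

theorem length_mat (G : SimpleGraph (Fin n)) : (mat G).length = n := by simp [mat]

theorem mem_vec (v : Fin n) : mem (vec s) v = true ↔ v ∈ s := by
  simp [mem, vec, List.getD_eq_getElem?_getD]

theorem adj_mat (i j : Fin n) : adj (mat G) i j = true ↔ G.Adj i j := by
  simp [adj, mat, List.getD_eq_getElem?_getD]

theorem adjEq_mat (i j : Fin n) : adjEq (mat G) i j = true ↔ i = j ∨ G.Adj i j := by
  simp [adjEq, adj_mat, Fin.ext_iff]

theorem vec_injective : Function.Injective (vec : Set (Fin n) → List Bool) := fun s t h => by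
  ext v
  rw [← mem_vec, ← mem_vec, h]

theorem any_range (p : ℕ → Bool) : (List.range n).any p = true ↔ ∃ v : Fin n, p v = true := by
  simp [Fin.exists_iff]

theorem all_range (p : ℕ → Bool) : (List.range n).all p = true ↔ ∀ v : Fin n, p v = true := by
  simp [Fin.forall_iff]

theorem tab_eq {p : ℕ → Bool} (h : ∀ v : Fin n, p v = true ↔ v ∈ s) : tab n p = vec s := by
  refine List.ext_getElem (by simp [tab, vec]) fun i h₁ h₂ => ?_
  have hi : i < n := by simpa [tab] using h₁
  have := h ⟨i, hi⟩
  rw [Bool.eq_iff_iff]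
  simpa [tab, vec] using this

theorem tab₂_eq {p : ℕ → ℕ → Bool} (h : ∀ i j : Fin n, p i j = true ↔ G.Adj i j) :
    tab₂ n p = mat G := by
  refine List.ext_getElem (by simp [tab₂, mat]) fun i h₁ h₂ => ?_
  have hi : i < n := by simpa [tab₂] using h₁
  have := tab_eq (s := {j | G.Adj ⟨i, hi⟩ j}) (p := p i) fun j => h ⟨i, hi⟩ j
  simpa [tab₂, mat, tab, vec] using this

/-- Iterating an inflationary function on sets `n` times leads to a fixed point. -/
theorem iterate_fixed (f : Set (Fin n) → Set (Fin n)) (hf : ∀ s, s ⊆ f s) (s : Set (Fin n)) :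
    f (f^[n] s) = f^[n] s := by
  -- As long as the iteration is not stationary, each step adds a vertex.
  have key : ∀ m, f (f^[m] s) = f^[m] s ∨ m < (f (f^[m] s)).ncard := by
    intro m
    induction m with
    | zero =>
      refine or_iff_not_imp_left.2 fun h => ?_
      have := Set.ncard_lt_ncard ((hf (f^[0] s)).ssubset_of_ne (Ne.symm h)) (Set.toFinite _)
      omega
    | succ m ih =>
      rw [Function.iterate_succ_apply']
      refine or_iff_not_imp_left.2 fun h => ?_
      have h₁ := ih.resolve_left fun h' => h (congrArg f h')
      have := Set.ncard_lt_ncard ((hf (f (f^[m] s))).ssubset_of_ne (Ne.symm h)) (Set.toFinite _)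
      omega
  refine (key n).resolve_right fun h => ?_
  have := Set.ncard_le_card (f (f^[n] s))
  rw [Nat.card_eq_fintype_card, Fintype.card_fin] at this
  omega

theorem component_eq (c : Fin n) :
    component n (mat G) (vec U) c = vec {v | Conn G U c v} := by
  let f : Set (Fin n) → Set (Fin n) := fun S => S ∪ {v | v ∈ U ∧ ∃ u ∈ S, G.Adj u v}
  let s₀ : Set (Fin n) := {v | v = c ∧ v ∈ U}
  have h₀ : ∀ m, (List.range m).foldl (fun S _ => growStep n (mat G) (vec U) S)
      (tab n fun v => v == (c : ℕ) && mem (vec U) v) = vec (f^[m] s₀) := by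
    intro m
    induction m with
    | zero => exact tab_eq fun v => by simp [mem_vec, s₀, Fin.ext_iff]
    | succ m ih =>
      rw [List.range_succ, List.foldl_append, ih, Function.iterate_succ_apply']
      refine tab_eq fun v => ?_
      simp only [Bool.or_eq_true, Bool.and_eq_true, mem_vec, any_range, adj_mat]
      rfl
  rw [component, h₀]
  congr 1
  have hf : ∀ s, s ⊆ f s := fun s => Set.subset_union_left
  refine Set.Subset.antisymm ?_ fun v hv => ?_
  · suffices h : ∀ m, f^[m] s₀ ⊆ {v | Conn G U c v} from h n
    intro m
    induction m with
    | zero => rintro v ⟨rfl, hv⟩; exact Conn.refl hv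
    | succ m ih =>
      rw [Function.iterate_succ_apply']
      rintro v (hv | ⟨hv, u, hu, huv⟩)
      · exact ih hv
      · exact (ih hu).tail huv hv
  · refine hv.induction (P := fun v => v ∈ f^[n] s₀) ?_ fun x y _ hx hxy hy => ?_
    · have hmono : ∀ m, s₀ ⊆ f^[m] s₀ := by
        intro m
        induction m with
        | zero => exact le_rfl
        | succ m ih =>
          rw [Function.iterate_succ_apply']
          exact ih.trans (hf _)
      exact hmono n ⟨rfl, hv.1⟩
    · rw [← iterate_fixed f hf]
      exact .inr ⟨hy, x, hx, hxy⟩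

theorem attach_eq (c : Fin n) : attach n (mat G) (vec U) c = vec {v | Att G U c v} :=
  tab_eq fun v => by
    simp only [component_eq, Bool.and_eq_true, any_range, mem_vec, adj_mat, Bool.not_eq_true',
      ← Bool.not_eq_true]
    rfl

theorem fillStep_eq (w : Fin n) : fillStep n (mat G) w = mat (completeAt G w) := by
  have h : (tab n fun v => !(v == (w : ℕ)) && !adj (mat G) w v) = vec (far G w) :=
    tab_eq fun v => by
      simp [far, ← Bool.not_eq_true, adj_mat, Fin.ext_iff]
  refine tab₂_eq fun i j => ?_
  simp only [h, Bool.or_eq_true, adj_mat, Bool.and_eq_true, any_range, attach_eq, mem_vec,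
    completeAt, Bool.not_eq_true', beq_eq_false_iff_ne, ne_eq, Fin.ext_iff]
  rfl

theorem fill_eq : fill n (mat G) = mat ((List.finRange n).foldl completeAt G) := by
  have key : ∀ (l : List (Fin n)) (G : SimpleGraph (Fin n)),
      (l.map Fin.val).foldl (fillStep n) (mat G) = mat (l.foldl completeAt G) := by
    intro l
    induction l with
    | nil => exact fun G => rfl
    | cons w l ih =>
      intro G
      rw [List.map_cons, List.foldl_cons, fillStep_eq, ih, List.foldl_cons]
  rw [fill, ← key, List.map_coe_finRange_eq_range]

theorem isolate_eq : isolate n (mat G) (vec Z) = mat (isolateAt G Z) :=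
  tab₂_eq fun i j => by
    simp [adj_mat, ← Bool.not_eq_true, mem_vec, isolateAt]

theorem pick_eq (u v x y : Fin n) : pick n (mat G) u v x y = vec (pickSet G u v x y) :=
  tab_eq fun w => by
    simp only [Bool.and_eq_true, adjEq_mat, all_range, Bool.or_eq_true, Bool.not_eq_true',
      ← Bool.not_eq_true, adj_mat, pickSet, Set.mem_ofPred_eq]
    refine and_congr_right' (and_congr_right' (forall_congr' fun s => ?_))
    tauto

/-- The candidates in terms of a safe triangulation. -/
theorem exists_candidates_iff (G : SimpleGraph (Fin n)) (Z : Set (Fin n)) :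
    ∃ H, IsSafeTriangulation (isolateAt G Z) H ∧ ∀ T, T ∈ candidates n (mat G) (vec Z) ↔
      T = vec Z ∨ ∃ u v x y z, T = vec (Z ∪ ({z} ∪ pickSet H u v x y)) := by
  refine ⟨_, isSafeTriangulation_foldl _ (List.finRange n) List.mem_finRange, fun T => ?_⟩
  have h : ∀ u v x y z : Fin n, (tab n fun w => mem (vec Z) w || (w == (z : ℕ) ||
      mem (pick n (fill n (isolate n (mat G) (vec Z))) u v x y) w)) =
      vec (Z ∪ ({z} ∪ pickSet ((List.finRange n).foldl completeAt (isolateAt G Z)) u v x y)) :=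
    fun u v x y z => tab_eq fun w => by
      simp [isolate_eq, fill_eq, pick_eq, mem_vec, Fin.ext_iff]
      tauto
  simp only [candidates, List.mem_cons, List.mem_flatMap, List.mem_map, List.mem_range, ← h,
    Fin.exists_iff, exists_prop, eq_comm (a := T)]

theorem isPMC_iff (Ω : Finset (Fin n)) :
    isPMC n (mat G) (vec (Ω : Set (Fin n))) = true ↔ IsPotentialMaximalClique G Ω := by
  have h : (tab n fun v => !mem (vec (Ω : Set (Fin n))) v) = vec (Ω : Set (Fin n))ᶜ :=
    tab_eq fun v => by simp [← Bool.not_eq_true, mem_vec]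
  rw [isPotentialMaximalClique_iff]
  simp only [isPMC, h, Bool.and_eq_true, all_range, Bool.or_eq_true, mem_vec, any_range,
    attach_eq, Bool.not_eq_true', ← Bool.not_eq_true, adjEq_mat, Set.mem_ofPred_eq, NoFull,
    Cliquish]
  refine and_congr (forall_congr' fun c => or_iff_not_imp_left) ⟨fun H u hu v hv huv => ?_,
    fun H u v => ?_⟩
  · rcases H u v with h | (h | h) | ⟨c, hc⟩
    · exact absurd ⟨hu, hv⟩ h
    · exact absurd h huv
    · exact .inl h
    · exact .inr ⟨c, hc.1.mem, hc⟩
  · by_cases huv : u = v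
    · exact .inr (.inl (.inl huv))
    · refine or_iff_not_imp_left.2 fun h => ?_
      rw [not_not] at h
      rcases H u h.1 v h.2 huv with h | ⟨c, -, hc⟩
      · exact .inl (.inr h)
      · exact .inr ⟨c, hc⟩

theorem isCliqueOff_iff : isCliqueOff n (mat G) (vec Ω) (vec Z) = true ↔ G.IsClique (Ω \ Z) := by
  simp only [isCliqueOff, all_range, Bool.or_eq_true, Bool.not_eq_true', ← Bool.not_eq_true,
    Bool.and_eq_true, mem_vec, adjEq_mat]
  constructor
  · intro h i hi j hj hij
    exact ((h i j).resolve_left (not_not.2 ⟨hi, hj⟩)).resolve_left hij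
  · intro h i j
    refine or_iff_not_imp_left.2 fun h' => or_iff_not_imp_left.2 fun hij => ?_
    rw [not_not] at h'
    exact h h'.1 h'.2 hij

theorem same_iff (s t : Set (Fin n)) : same n (vec s) (vec t) = true ↔ s = t := by
  simp only [same, all_range, beq_iff_eq, Set.ext_iff]
  refine forall_congr' fun v => ?_
  rw [Bool.eq_iff_iff, mem_vec, mem_vec]

/-- `same` compares only the first `n` entries, so it decides equality only for lists known to be
bit vectors of vertex sets. -/
theorem dedup_spec (L : List (List Bool)) (hL : ∀ T ∈ L, ∃ s : Set (Fin n), T = vec s) :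
    (dedup n L).Nodup ∧ ∀ T, T ∈ dedup n L ↔ T ∈ L := by
  induction L using List.reverseRecOn with
  | nil => exact ⟨List.nodup_nil, fun T => Iff.rfl⟩
  | append_singleton L S ih =>
    obtain ⟨h₁, h₂⟩ := ih fun T hT => hL T (List.mem_append_left _ hT)
    have hS : (dedup n L).any (same n S) = true ↔ S ∈ L := by
      rw [List.any_eq_true, ← h₂]
      obtain ⟨s, rfl⟩ := hL S (by simp)
      constructor
      · rintro ⟨T, hT, h⟩
        obtain ⟨t, rfl⟩ := hL T (List.mem_append_left _ ((h₂ T).1 hT))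
        rwa [(same_iff s t).1 h]
      · exact fun h => ⟨_, h, (same_iff s s).2 rfl⟩
    rw [dedup_concat]
    cases h : (dedup n L).any (same n S)
    · have hS' : S ∉ dedup n L := fun h' => by simp [hS.2 ((h₂ S).1 h')] at h
      refine ⟨List.nodup_cons.2 ⟨hS', h₁⟩, fun T => ?_⟩
      simp [h₂, or_comm]
    · refine ⟨h₁, fun T => ?_⟩
      have := hS.1 h
      simp only [cond_true, h₂, List.mem_append, List.mem_singleton]
      exact ⟨.inl, by rintro (h | rfl) <;> assumption⟩

theorem mem_smallSets (m : ℕ) (T : List Bool) : T ∈ smallSets n m ↔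
    ∃ S : Finset (Fin n), S.card ≤ m ∧ T = vec (S : Set (Fin n)) := by
  induction m generalizing T with
  | zero =>
    have h : (tab n fun _ => false) = vec (∅ : Set (Fin n)) := tab_eq fun v => by simp
    simp [smallSets, h]
  | succ m ih =>
    have h : ∀ (S : Set (Fin n)) (v : Fin n),
        (tab n fun w => mem (vec S) w || w == (v : ℕ)) = vec (insert v S) := fun S v =>
      tab_eq fun w => by simp [mem_vec, Fin.ext_iff, or_comm]
    simp only [smallSets_succ, smallStep, List.mem_append, ih, List.mem_flatMap, List.mem_map,
      List.mem_range]
    constructor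
    · rintro (⟨S, hS, rfl⟩ | ⟨_, ⟨S, hS, rfl⟩, v, hv, rfl⟩)
      · exact ⟨S, by omega, rfl⟩
      · refine ⟨insert ⟨v, hv⟩ S, (Finset.card_insert_le _ _).trans (by omega), ?_⟩
        rw [Finset.coe_insert]
        exact h S ⟨v, hv⟩
    · rintro ⟨S, hS, rfl⟩
      rcases hS.lt_or_eq with hS | hS
      · exact .inl ⟨S, by omega, rfl⟩
      · obtain ⟨v, S', hv, rfl, hS'⟩ := Finset.card_eq_succ.1 hS
        refine .inr ⟨_, ⟨S', hS'.le, rfl⟩, v, v.isLt, ?_⟩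
        rw [Finset.coe_insert]
        exact h S' v

theorem card_le_iff (m k : ℕ) : (m : ℝ) ≤ 5 * √(k : ℝ) ↔ m ≤ sizeBound k := by
  refine ⟨fun h => ?_, fun h => (Nat.cast_le.2 h).trans (sizeBound_le k)⟩
  rw [sizeBound_eq, Nat.le_sqrt]
  have h₁ : (m : ℝ) * m ≤ 5 * √(k : ℝ) * (5 * √(k : ℝ)) :=
    mul_le_mul h h (by positivity) (by positivity)
  have h₂ := Real.mul_self_sqrt (show (0 : ℝ) ≤ k by positivity)
  have : (m : ℝ) * m ≤ 25 * k := by nlinarith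
  exact_mod_cast this

/-- Soundness rests on the final tests alone, completeness on `exists_eq_pickSet`. The set that
generates `Ω` may differ from the one certifying the clique condition, so the test ranges over all
small sets. -/
theorem enumerate_spec (G : SimpleGraph (Fin n)) (k : ℕ) :
    (enumerate (mat G) (smallSets n (sizeBound k))).Nodup ∧
    ∀ T, T ∈ enumerate (mat G) (smallSets n (sizeBound k)) ↔
      ∃ Ω : Finset (Fin n), T = vec (Ω : Set (Fin n)) ∧ IsQuasiClique G k Ω := by
  classical
  have hvec : ∀ T ∈ (smallSets n (sizeBound k)).flatMap (candidates n (mat G)),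
      ∃ Ω : Finset (Fin n), T = vec (Ω : Set (Fin n)) := by
    intro T hT
    obtain ⟨_, hZ, hT⟩ := List.mem_flatMap.1 hT
    obtain ⟨Z, -, rfl⟩ := (mem_smallSets _ _).1 hZ
    obtain ⟨H, -, h⟩ := exists_candidates_iff G (Z : Set (Fin n))
    rcases (h T).1 hT with rfl | ⟨u, v, x, y, z, rfl⟩
    · exact ⟨Z, rfl⟩
    · exact ⟨(Z ∪ ({z} ∪ pickSet H u v x y) : Set (Fin n)).toFinset, by rw [Set.coe_toFinset]⟩
  obtain ⟨h₁, h₂⟩ := dedup_spec (n := n)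
    (((smallSets n (sizeBound k)).flatMap (candidates n (mat G))).filter fun Ω =>
      isPMC n (mat G) Ω && (smallSets n (sizeBound k)).any (isCliqueOff n (mat G) Ω))
    fun T hT => (hvec T (List.mem_of_mem_filter hT)).imp' _ fun _ h => h
  simp only [enumerate, length_mat]
  refine ⟨h₁, fun T => (h₂ T).trans ?_⟩
  simp only [List.mem_filter, Bool.and_eq_true, List.any_eq_true]
  constructor
  · rintro ⟨hT, hpmc, _, hmem, hcl⟩
    obtain ⟨Ω, rfl⟩ := hvec T hT
    obtain ⟨Z, hZ, rfl⟩ := (mem_smallSets _ _).1 hmem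
    -- The set found by the test need not lie inside `Ω`; intersecting with `Ω` changes neither the
    -- bound nor the difference.
    refine ⟨Ω, rfl, (isPMC_iff Ω).1 hpmc, Z ∩ Ω, Finset.inter_subset_right, ?_, ?_⟩
    · exact (card_le_iff _ _).2 ((Finset.card_le_card Finset.inter_subset_left).trans hZ)
    · rw [Finset.coe_inter, Set.sdiff_inter_self_eq_sdiff]
      exact isCliqueOff_iff.1 hcl
  · rintro ⟨Ω, rfl, hpmc, Z, hZΩ, hZ, hcl⟩
    rw [card_le_iff] at hZ
    refine ⟨?_, (isPMC_iff Ω).2 hpmc, vec (Z : Set (Fin n)), (mem_smallSets _ _).2 ⟨Z, hZ, rfl⟩,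
      isCliqueOff_iff.2 hcl⟩
    obtain ⟨hfull, hclq⟩ := (isPotentialMaximalClique_iff Ω).1 hpmc
    rw [List.mem_flatMap]
    rcases exists_eq_pickSet hfull hclq (Finset.coe_subset.2 hZΩ) hcl with h | ⟨Z', hZ', h⟩
    · obtain ⟨H, -, hc⟩ := exists_candidates_iff G (Z : Set (Fin n))
      exact ⟨_, (mem_smallSets _ _).2 ⟨Z, hZ, rfl⟩, (hc _).2 (.inl (by rw [h]))⟩
    · obtain ⟨H, hH, hc⟩ := exists_candidates_iff G Z'
      obtain ⟨u, v, x, y, z, h⟩ := h H hH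
      refine ⟨vec Z', (mem_smallSets _ _).2 ⟨Z'.toFinset, ?_, by rw [Set.coe_toFinset]⟩,
        (hc _).2 (.inr ⟨u, v, x, y, z, by rw [h]⟩)⟩
      exact (Finset.card_le_card fun a ha => hZ' (Set.mem_toFinset.1 ha)).trans hZ

end Alg

end FillIn

namespace FillIn

open Enc

namespace Alg

/-! ### Input and output -/

theorem encodeVertexSet_eq {n : ℕ} (S : Finset (Fin n)) :
    encodeVertexSet S = enc (vec (S : Set (Fin n))) := by
  simp only [encodeVertexSet, vec, Finset.mem_coe]
  change _ = encodeList encodeBool _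
  congr!

theorem wd_instance_le {n : ℕ} (G : SimpleGraph (Fin n)) (k : ℕ) :
    wd (mat G, k.bits) ≤ n + k + 3 := by
  have h₁ : wd (mat G) ≤ n + 1 := by
    rw [wd_list_le]
    refine ⟨by simp [mat], fun a ha => ?_⟩
    simp only [mat, List.mem_ofFn] at ha
    obtain ⟨i, rfl⟩ := ha
    rw [wd_list_le]
    exact ⟨by simp, fun b _ => (wd_bool b).trans (by omega)⟩
  have h₂ : wd k.bits ≤ k + 1 := by
    rw [wd_list_le]
    refine ⟨?_, fun b _ => (wd_bool b).trans (by omega)⟩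
    rw [Nat.size_eq_bits_len]
    exact (Nat.size_le.2 k.lt_two_pow_self).trans (by omega)
  have := wd_prod_le (mat G, k.bits)
  dsimp only at this
  omega

theorem exists_list {n : ℕ} (G : SimpleGraph (Fin n)) (k : ℕ) :
    ∃ L : List (Finset (Fin n)), L.Nodup ∧ (∀ Ω, Ω ∈ L ↔ IsQuasiClique G k Ω) ∧
      encodeList encodeVertexSet L = enc (quasiCliques (mat G, k.bits)) := by
  classical
  obtain ⟨h₁, h₂⟩ := enumerate_spec G k
  have hq : quasiCliques (mat G, k.bits) = enumerate (mat G) (smallSets n (sizeBound k)) := by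
    simp only [quasiCliques, length_mat, value_bits]
  rw [hq]
  set l := enumerate (mat G) (smallSets n (sizeBound k))
  let code : Finset (Fin n) → List Bool := fun Ω => vec (Ω : Set (Fin n))
  have hinj : Function.Injective code := fun S T h => Finset.coe_injective (vec_injective h)
  obtain ⟨L, hL⟩ : ∃ L : List (Finset (Fin n)), L.map code = l := by
    have : ∀ T ∈ l, T ∈ Set.range code := fun T hT =>
      let ⟨Ω, h, _⟩ := (h₂ T).1 hT
      ⟨Ω, h.symm⟩
    rwa [← Set.mem_range, Set.range_list_map]
  refine ⟨L, .of_map code (hL ▸ h₁), fun Ω => ?_, ?_⟩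
  · rw [← List.mem_map_of_injective hinj, hL, h₂]
    exact ⟨fun ⟨Ω', h, hq⟩ => hinj h ▸ hq, fun hq => ⟨Ω, rfl, hq⟩⟩
  · rw [← hL]
    clear hL
    induction L with
    | nil => rfl
    | cons S L ih => exact congrArg₂ Tree.cons (encodeVertexSet_eq S) ih

end Alg

end FillIn

/-- One program and one constant `c` serve all instances `(G, k)`. On `(G, k)` the program outputs
the list of all quasi-cliques, each exactly once, within time `n ^ (c √k)`. The two `max` only
matter for `n ≤ 1` and for `k = 0`, where `n ^ (c √k)` is at most one. -/
theorem mainTheorem8 :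
    ∃ (p : FillIn.Com) (c : ℕ), ∀ (n k : ℕ) (G : SimpleGraph (Fin n)),
      ∃ (L : List (Finset (Fin n))) (t : ℕ),
        L.Nodup ∧
        (∀ Ω : Finset (Fin n), Ω ∈ L ↔ FillIn.IsQuasiClique G k Ω) ∧
        FillIn.Outputs p (FillIn.encodeInstance G k)
          (FillIn.encodeList FillIn.encodeVertexSet L) t ∧
        (t : ℝ) ≤ ((max n 2 : ℕ) : ℝ) ^ ((c : ℝ) * √((max k 1 : ℕ) : ℝ)) := by
  obtain ⟨T, ⟨d, hd⟩, hp⟩ := FillIn.Alg.timed_quasiCliques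
  obtain ⟨p, hp⟩ := hp 0
  -- The time is at most `(cost + 2) ^ d`, and 16 is the exponent from `cost_le`.
  refine ⟨p, 16 * d, fun n k G => ?_⟩
  obtain ⟨L, hnodup, hmem, henc⟩ := FillIn.Alg.exists_list G k
  obtain ⟨σ, t, hexec, hout, -, ht⟩ := hp (FillIn.initStore (FillIn.encodeInstance G k))
    (FillIn.Alg.mat G, k.bits) rfl
  refine ⟨L, t, hnodup, hmem, ⟨σ, hexec, hout.trans henc.symm⟩, ?_⟩
  have hcost := FillIn.Alg.cost_le (x := (FillIn.Alg.mat G, k.bits)) (FillIn.Alg.length_mat G)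
    (FillIn.Alg.value_bits k) (FillIn.Alg.wd_instance_le G k)
  calc (t : ℝ) ≤ ((FillIn.Alg.cost (FillIn.Alg.mat G, k.bits) + 2 : ℕ) : ℝ) ^ d := by
        exact_mod_cast ht.trans (hd _)
    _ ≤ (((max n 2 : ℕ) : ℝ) ^ ((16 : ℝ) * √((max k 1 : ℕ) : ℝ))) ^ d := by gcongr
    _ = ((max n 2 : ℕ) : ℝ) ^ (((16 * d : ℕ) : ℝ) * √((max k 1 : ℕ) : ℝ)) := by
        rw [← Real.rpow_natCast, ← Real.rpow_mul (by positivity)]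
        congr 1
        push_cast
        ring
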